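/- Let $\theta\in(0,1)$, $\alpha\in(0,1)$ and $\Lambda\in(0,\infty)$. Consider the free-boundary problem for a speed $c>0$, a width $R>0$ and functions $u,v\in C^1([-R,0])\cap C^2((-R,0))$: $$\begin{aligned} &u''-cu'=-v^{\alpha},\quad \Lambda v''-cv'=v^{\alpha},\quad v>0 &&\text{on }(-R,0),\\ &u=\theta,\quad u'=c\theta &&\text{at }\xi=-R,\\ &u=1,\quad u'=0,\quad v=v'=0 &&\text{at }\xi=0. \end{aligned}$$ (i) This problem has exactly one solution $(u^*,v^*,c^*,R^*)$. (ii) A traveling front with speed $c>0$, ignition interface $a$ and trailing interface $b>a$ is a pair $(u,v)$ of $C^1$ functions on $\mathbb R$, of class $C^2$ on $(-\infty,a)$ and on $(a,b)$, such that $u''-cu'=0$, $\Lambda v''-cv'=0$, $v>0$ on $(-\infty,a)$; $u''-cu'=-v^\alpha$, $\Lambda v''-cv'=v^\alpha$, $v>0$ on $(a,b)$; $u=1$, $v=0$ on $[b,\infty)$; $u(a)=\theta$; and $u\to0$, $v\to1$ as $\xi\to-\infty$. There is a traveling front $(U,V)$ with speed $c^*$, ignition interface $-R^*$ and trailing interface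 $0$; it coincides with $(u^*,v^*)$ on $[-R^*,0]$, and it is unique up to translation: every traveling front, with any speed $c$ and interfaces $a<b$, satisfies $c=c^*$, $b-a=R^*$ and $(u,v)(\xi)=(U,V)(\xi-b)$ for all $\xi\in\mathbb R$. (iii) There is exactly one function $w\in C^1((-\infty,0])\cap C^2((-\infty,0))$ with $w>0$ and $\Lambda w''-w'-w^\alpha=0$ on $(-\infty,0)$ and $w(0)=w'(0)=0$. The function $$\varphi(x)=\frac{\int_{-x}^0 w^\alpha(s)\,e^{-(s+x)}\,ds}{\int_{-x}^0 w^\alpha(s)\,ds},\qquad x>0,$$ is a strictly decreasing bijection from $(0,\infty)$ onto $(0,1)$, and with $\sigma^*=\varphi^{-1}(\theta)$ one has $$c^*=\Big(\int_{-\sigma^*}^0 w^\alpha(s)\,ds\Big)^{\frac{1-\alpha}{2}},\qquad R^*=\frac{\sigma^*}{c^*}.$$ -/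

import Mathlib

open Set Filter Topology

noncomputable section

/-- Solutions `(u, v, c, R)` of the free-boundary problem on the reaction zone `[-R, 0]`, in the
classical sense: `C¹` on `[-R, 0]` and `C²` on `(-R, 0)`. The speed `c > 0` and the width `R > 0`
are unknowns. Values of `u` and `v` outside `[-R, 0]` are irrelevant. -/
structure IsReactionZoneSolution (θ α Λ : ℝ) (u v : ℝ → ℝ) (c R : ℝ) : Prop where
  speed_pos : 0 < c
  width_pos : 0 < R
  u_C1 : ContDiffOn ℝ 1 u (Icc (-R) 0)
  v_C1 : ContDiffOn ℝ 1 v (Icc (-R) 0)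
  u_C2 : ContDiffOn ℝ 2 u (Ioo (-R) 0)
  v_C2 : ContDiffOn ℝ 2 v (Ioo (-R) 0)
  u_eq : ∀ ξ ∈ Ioo (-R) 0, deriv (deriv u) ξ - c * deriv u ξ = -(v ξ) ^ α
  v_eq : ∀ ξ ∈ Ioo (-R) 0, Λ * deriv (deriv v) ξ - c * deriv v ξ = (v ξ) ^ α
  v_pos : ∀ ξ ∈ Ioo (-R) 0, 0 < v ξ
  u_ign : u (-R) = θ
  u_ign_deriv : HasDerivWithinAt u (c * θ) (Icc (-R) 0) (-R)
  u_tr : u 0 = 1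
  u_tr_deriv : HasDerivWithinAt u 0 (Icc (-R) 0) 0
  v_tr : v 0 = 0
  v_tr_deriv : HasDerivWithinAt v 0 (Icc (-R) 0) 0

/-- Traveling fronts on the whole line with speed `c`, ignition interface at `a` and trailing
interface at `b`. Being `C¹` on `ℝ` expresses the continuity of `u`, `v` and of their first
derivatives across both interfaces; together with `u = 1`, `v = 0` on `[b, ∞)` it contains the
conditions `u = 1`, `u' = 0`, `v = v' = 0` at `b`. -/
structure IsTravelingFront (θ α Λ : ℝ) (u v : ℝ → ℝ) (c a b : ℝ) : Prop where
  speed_pos : 0 < c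
  ign_lt_tr : a < b
  u_C1 : ContDiff ℝ 1 u
  v_C1 : ContDiff ℝ 1 v
  u_C2_left : ContDiffOn ℝ 2 u (Iio a)
  v_C2_left : ContDiffOn ℝ 2 v (Iio a)
  u_C2 : ContDiffOn ℝ 2 u (Ioo a b)
  v_C2 : ContDiffOn ℝ 2 v (Ioo a b)
  u_eq_left : ∀ ξ ∈ Iio a, deriv (deriv u) ξ - c * deriv u ξ = 0
  v_eq_left : ∀ ξ ∈ Iio a, Λ * deriv (deriv v) ξ - c * deriv v ξ = 0
  u_eq : ∀ ξ ∈ Ioo a b, deriv (deriv u) ξ - c * deriv u ξ = -(v ξ) ^ α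
  v_eq : ∀ ξ ∈ Ioo a b, Λ * deriv (deriv v) ξ - c * deriv v ξ = (v ξ) ^ α
  v_pos_left : ∀ ξ ∈ Iio a, 0 < v ξ
  v_pos : ∀ ξ ∈ Ioo a b, 0 < v ξ
  u_ign : u a = θ
  u_burned : ∀ ξ ∈ Ici b, u ξ = 1
  v_burned : ∀ ξ ∈ Ici b, v ξ = 0
  u_unburned : Tendsto u atBot (𝓝 0)
  v_unburned : Tendsto v atBot (𝓝 1)

/-- Positive solutions `w` on `(-∞, 0]` of `Λ w'' - w' - w ^ α = 0`, `w(0) = w'(0) = 0`.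
Values of `w` on `(0, ∞)` are irrelevant. -/
structure IsReactantProfile (α Λ : ℝ) (w : ℝ → ℝ) : Prop where
  w_C1 : ContDiffOn ℝ 1 w (Iic 0)
  w_C2 : ContDiffOn ℝ 2 w (Iio 0)
  w_eq : ∀ x ∈ Iio (0 : ℝ), Λ * deriv (deriv w) x - deriv w x - (w x) ^ α = 0
  w_pos : ∀ x ∈ Iio (0 : ℝ), 0 < w x
  w_zero : w 0 = 0
  w_zero_deriv : HasDerivWithinAt w 0 (Iic 0) 0

/-- `φ(x) = ∫_{-x}^0 w(s)^α e^{-(s+x)} ds / ∫_{-x}^0 w(s)^α ds`. -/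
def ignitionRatio (α : ℝ) (w : ℝ → ℝ) (x : ℝ) : ℝ :=
  (∫ s in (-x)..0, (w s) ^ α * Real.exp (-(s + x))) / ∫ s in (-x)..0, (w s) ^ α

end

/-!
Integrating the equation for `u` over the reaction zone shows that the conditions at `-R` amount to
`c = ∫ v ^ α` and `c θ = ∫ v ^ α exp (-c (ξ + R))`, while `v` solves a problem of its own. By
scaling, `v ξ = c ^ (-2 / (1 - α)) w (c ξ)` with the profile `w` for speed `1`, and with `σ = c R`
the two conditions become `c = (∫ w ^ α) ^ ((1 - α) / 2)` and `φ σ = θ`. So everything rests on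
existence and uniqueness of `w` and on the bijectivity of `φ`.

*Existence of `w`* (`exists_isReflectedProfile`). In the variable `y = -x` the profile is a fixed
point of the monotone Volterra operator `z ↦ ∫₀^y (1 - exp (-(y - s) / Λ)) z(s) ^ α ds`. A multiple
of `y ^ (2 / (1 - α))` is a supersolution; the iterates that start from it decrease, and smaller
multiples, which are subsolutions on bounded intervals, keep the limit positive.

*Uniqueness* (`lt_shift_of_volterra`, `eqOn_of_volterra`). The right-hand side is not Lipschitz at
`0`, but by the positivity of the kernel a solution translated by `ε > 0` to the right lies above
any other one. Letting `ε → 0` and exchanging the roles of the solutions gives equality.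

*Monotonicity of `φ`* (`IsReflectedProfile.strictAntiOn_ignitionRatio`). The equation implies
`(exp (y / Λ) (z z'' - z' ^ 2))' < 0`, hence `z` is strictly log-concave. Two applications of the
monotone form of l'Hôpital's rule turn this into monotonicity: `z / z'` increases, hence so does
`I / I'` for `I = ∫ z ^ α`, hence `φ` decreases. The limits `1` at `0` and `0` at `∞` follow from
`exp (-x) < φ x` and `φ ≤ I ^ (α - 1)`.

*Fronts.* Ahead of the ignition interface a front is a pair of exponentials
(`eq_tail_of_deriv_deriv`), so `u' = c θ` there, and a front restricts to a solution on the reaction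
zone. Conversely the tail for `v` matches at `-R` because `Λ v' - c v = -∫ v ^ α = -c` there.
-/

/-! ### The Volterra operator -/

/-- The solution `z` of `Λ z'' + z' = g`, `z 0 = z' 0 = 0`, given by variation of constants. -/
noncomputable def volterra (Λ : ℝ) (g : ℝ → ℝ) (y : ℝ) : ℝ :=
  ∫ s in (0 : ℝ)..y, (1 - Real.exp (-(y - s) / Λ)) * g s

lemma IntervalIntegrable.exp_div_mul {g : ℝ → ℝ}
    (hg : ∀ a b, IntervalIntegrable g MeasureTheory.volume a b) (Λ a b : ℝ) :
    IntervalIntegrable (fun s => Real.exp (s / Λ) * g s) MeasureTheory.volume a b :=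
  (hg a b).continuousOn_mul (by fun_prop)

lemma volterra_eq {Λ : ℝ} {g : ℝ → ℝ}
    (hg : ∀ a b, IntervalIntegrable g MeasureTheory.volume a b) (y : ℝ) :
    volterra Λ g y = (∫ s in (0 : ℝ)..y, g s) -
      Real.exp (-y / Λ) * ∫ s in (0 : ℝ)..y, Real.exp (s / Λ) * g s := by
  rw [volterra, ← intervalIntegral.integral_const_mul, ← intervalIntegral.integral_sub (hg _ _)
    ((IntervalIntegrable.exp_div_mul hg Λ 0 y).const_mul _)]
  refine intervalIntegral.integral_congr fun s _ => ?_
  have : Real.exp (-(y - s) / Λ) = Real.exp (-y / Λ) * Real.exp (s / Λ) := by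
    rw [← Real.exp_add]; ring_nf
  simp only [this]; ring

lemma continuous_volterra {Λ : ℝ} {g : ℝ → ℝ}
    (hg : ∀ a b, IntervalIntegrable g MeasureTheory.volume a b) : Continuous (volterra Λ g) := by
  rw [funext (volterra_eq hg)]
  have h1 := intervalIntegral.continuous_primitive hg 0
  have h2 := intervalIntegral.continuous_primitive (IntervalIntegrable.exp_div_mul hg Λ) 0
  have h3 : Continuous fun y : ℝ => Real.exp (-y / Λ) := by fun_prop
  exact h1.sub (h3.mul h2)

lemma hasDerivAt_volterra {Λ : ℝ} {g : ℝ → ℝ} (hg : Continuous g) (y : ℝ) :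
    HasDerivAt (volterra Λ g)
      (1 / Λ * (Real.exp (-y / Λ) * ∫ s in (0 : ℝ)..y, Real.exp (s / Λ) * g s)) y := by
  rw [funext (volterra_eq fun a b => hg.intervalIntegrable a b)]
  have h1 := hg.integral_hasStrictDerivAt 0 y |>.hasDerivAt
  have h2 := (show Continuous fun s => Real.exp (s / Λ) * g s by fun_prop).integral_hasStrictDerivAt
    0 y |>.hasDerivAt
  have h3 : HasDerivAt (fun y : ℝ => Real.exp (-y / Λ)) (Real.exp (-y / Λ) * (-1 / Λ)) y :=
    ((hasDerivAt_id y).neg.div_const Λ).exp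
  refine (h1.sub (h3.mul h2)).congr_deriv ?_
  have : Real.exp (-y / Λ) * Real.exp (y / Λ) = 1 := by rw [← Real.exp_add]; ring_nf; simp
  linear_combination (-g y) * this

lemma volterra_of_nonpos {Λ : ℝ} {g : ℝ → ℝ} (hg : ∀ s ≤ 0, g s = 0) {y : ℝ} (hy : y ≤ 0) :
    volterra Λ g y = 0 := by
  rw [volterra]
  refine (intervalIntegral.integral_congr (g := fun _ => 0) fun s hs => ?_).trans (by simp)
  rw [uIcc_of_ge hy] at hs
  simp [hg s hs.2]

lemma one_sub_exp_nonneg {Λ t : ℝ} (hΛ : 0 < Λ) (ht : 0 ≤ t) : 0 ≤ 1 - Real.exp (-t / Λ) := by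
  have : Real.exp (-t / Λ) ≤ 1 := Real.exp_le_one_iff.2 (by
    rw [neg_div]; have := div_nonneg ht hΛ.le; linarith)
  linarith

lemma volterra_mono {Λ : ℝ} (hΛ : 0 < Λ) {g h : ℝ → ℝ} (hg : Continuous g) (hh : Continuous h)
    {y : ℝ} (hy : 0 ≤ y) (hgh : ∀ s ∈ Icc 0 y, g s ≤ h s) : volterra Λ g y ≤ volterra Λ h y := by
  refine intervalIntegral.integral_mono_on hy
    (Continuous.intervalIntegrable (by fun_prop) _ _)
    (Continuous.intervalIntegrable (by fun_prop) _ _) fun s hs => ?_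
  exact mul_le_mul_of_nonneg_left (hgh s hs) (one_sub_exp_nonneg hΛ (by linarith [hs.2]))

/-! ### Power barriers -/

/-- The function `(m y²) ^ (1 / (1 - α))` for `y ≥ 0`, extended by zero. -/
noncomputable def powerBarrier (α m y : ℝ) : ℝ := (m * (max y 0) ^ 2) ^ (1 / (1 - α))

section Barrier

variable {α m : ℝ}

lemma powerBarrier_nonneg (hm : 0 ≤ m) (y : ℝ) : 0 ≤ powerBarrier α m y := by
  unfold powerBarrier; positivity

lemma powerBarrier_of_nonpos (hα : α < 1) {y : ℝ} (hy : y ≤ 0) : powerBarrier α m y = 0 := by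
  have : (1 / (1 - α)) ≠ 0 := (one_div_pos.2 (by linarith)).ne'
  rw [powerBarrier, max_eq_right hy, zero_pow two_ne_zero, mul_zero, Real.zero_rpow this]

lemma powerBarrier_pos (hm : 0 < m) {y : ℝ} (hy : 0 < y) : 0 < powerBarrier α m y := by
  unfold powerBarrier
  rw [max_eq_left hy.le]; positivity

lemma continuous_powerBarrier (hα : α < 1) : Continuous (powerBarrier α m) := by
  have : 0 ≤ 1 / (1 - α) := (one_div_pos.2 (by linarith)).le
  unfold powerBarrier
  exact Continuous.rpow_const (by fun_prop) fun _ => Or.inr this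

lemma powerBarrier_mono (hα : α < 1) (hm : 0 ≤ m) {x y : ℝ} (hxy : x ≤ y) :
    powerBarrier α m x ≤ powerBarrier α m y := by
  have : 0 ≤ 1 / (1 - α) := (one_div_pos.2 (by linarith)).le
  unfold powerBarrier
  gcongr

lemma powerBarrier_le_of_le (hα : α < 1) {m' : ℝ} (hm : 0 ≤ m) (h : m ≤ m') (y : ℝ) :
    powerBarrier α m y ≤ powerBarrier α m' y := by
  have : 0 ≤ 1 / (1 - α) := (one_div_pos.2 (by linarith)).le
  unfold powerBarrier
  gcongr

/-- The exponent `1 / (1 - α)` makes the barrier a fixed point of `b ↦ m y² b ^ α`. -/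
lemma powerBarrier_rpow_mul (hα : α < 1) (hm : 0 ≤ m) (y : ℝ) :
    m * (max y 0) ^ 2 * powerBarrier α m y ^ α = powerBarrier α m y := by
  unfold powerBarrier
  have hx : 0 ≤ m * (max y 0) ^ 2 := by positivity
  generalize m * (max y 0) ^ 2 = x at *
  have h1 : (1 - α) ≠ 0 := by linarith
  rcases hx.eq_or_lt with rfl | hx
  · rw [Real.zero_rpow (one_div_ne_zero h1)]; simp
  · rw [← Real.rpow_mul hx.le]
    nth_rw 1 [← Real.rpow_one x]
    rw [← Real.rpow_add hx]
    congr 1; field_simp; ring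

lemma powerBarrier_quarter (hm : 0 ≤ m) {y : ℝ} (hy : 0 ≤ y) :
    powerBarrier α m (y / 4) = (1 / 16 : ℝ) ^ (1 / (1 - α)) * powerBarrier α m y := by
  unfold powerBarrier
  rw [max_eq_left hy, max_eq_left (by positivity), ← Real.mul_rpow (by positivity) (by positivity)]
  congr 1; ring

end Barrier

lemma continuous_rpow_of_pos {α : ℝ} (hα : 0 < α) {f : ℝ → ℝ} (hf : Continuous f) :
    Continuous fun s => f s ^ α := hf.rpow_const fun _ => Or.inr hα.le

/-- `powerBarrier α Λ⁻¹` is a supersolution, because `1 - exp (-t / Λ) ≤ t / Λ`. -/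
lemma volterra_le_powerBarrier {α Λ : ℝ} (hα : α ∈ Ioo (0 : ℝ) 1) (hΛ : 0 < Λ) {y : ℝ}
    (hy : 0 ≤ y) :
    volterra Λ (fun s => powerBarrier α Λ⁻¹ s ^ α) y ≤ powerBarrier α Λ⁻¹ y := by
  have hc := continuous_rpow_of_pos hα.1 (continuous_powerBarrier (m := Λ⁻¹) hα.2)
  have hm : 0 ≤ Λ⁻¹ := by positivity
  calc volterra Λ (fun s => powerBarrier α Λ⁻¹ s ^ α) y
      ≤ ∫ _ in (0 : ℝ)..y, y / Λ * powerBarrier α Λ⁻¹ y ^ α := by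
        refine intervalIntegral.integral_mono_on hy
          (Continuous.intervalIntegrable (by fun_prop) _ _) (by simp) fun s hs => ?_
        have h0 := powerBarrier_nonneg (α := α) hm s
        refine mul_le_mul ?_ (Real.rpow_le_rpow h0 (powerBarrier_mono hα.2 hm hs.2) hα.1.le)
          (Real.rpow_nonneg h0 _) (by positivity)
        have h1 := Real.add_one_le_exp (-(y - s) / Λ)
        have h2 : (y - s) / Λ ≤ y / Λ := by gcongr; linarith [hs.1]
        rw [neg_div] at h1 ⊢
        linarith
    _ = Λ⁻¹ * (max y 0) ^ 2 * powerBarrier α Λ⁻¹ y ^ α := by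
        rw [intervalIntegral.integral_const, max_eq_left hy, smul_eq_mul]; ring
    _ = _ := powerBarrier_rpow_mul hα.2 hm y

/-- On a bounded interval `1 - exp (-t / Λ)` is bounded below by a multiple of `t`, so that a small
multiple of the barrier is a subsolution there. -/
lemma exists_powerBarrier_le_volterra {α Λ : ℝ} (hα : α ∈ Ioo (0 : ℝ) 1) (hΛ : 0 < Λ) {B : ℝ}
    (hB : 0 ≤ B) :
    ∃ m, 0 < m ∧ m ≤ Λ⁻¹ ∧ ∀ y ∈ Icc 0 B,
      powerBarrier α m y ≤ volterra Λ (fun s => powerBarrier α m s ^ α) y := by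
  set κ : ℝ := ((1 / 16 : ℝ) ^ (1 / (1 - α))) ^ α with hκ
  have hγ : 0 < 1 / (1 - α) := one_div_pos.2 (by linarith [hα.2])
  have hκ1 : κ ≤ 1 := Real.rpow_le_one (by positivity)
    (Real.rpow_le_one (by norm_num) (by norm_num) hγ.le) hα.1.le
  have hκ0 : 0 < κ := by positivity
  have he1 : Real.exp (-B / Λ) ≤ 1 := sub_nonneg.1 (one_sub_exp_nonneg hΛ hB)
  -- the integral over `[y / 4, y / 2]` alone suffices: there `y - s ≥ y / 2`, and the barrier is at
  -- least `16 ^ (-1 / (1 - α))` times its value at `y`; with the length `y / 4` this gives `1 / 8`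
  refine ⟨Real.exp (-B / Λ) * κ / 8 * Λ⁻¹, by positivity, ?_, fun y hy => ?_⟩
  · have : Real.exp (-B / Λ) * κ ≤ 1 := mul_le_one₀ he1 hκ0.le hκ1
    exact mul_le_of_le_one_left (by positivity) (by linarith)
  set m := Real.exp (-B / Λ) * κ / 8 * Λ⁻¹ with hmdef
  have hm : 0 ≤ m := by positivity
  have hy0 := hy.1
  have hc := continuous_rpow_of_pos hα.1 (continuous_powerBarrier (m := m) hα.2)
  have hci : ∀ a b, IntervalIntegrable (fun s => (1 - Real.exp (-(y - s) / Λ)) *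
    powerBarrier α m s ^ α) MeasureTheory.volume a b :=
    fun a b => Continuous.intervalIntegrable (by fun_prop) _ _
  have hnn : ∀ s ≤ y, 0 ≤ (1 - Real.exp (-(y - s) / Λ)) * powerBarrier α m s ^ α := fun s hs =>
    mul_nonneg (one_sub_exp_nonneg hΛ (by linarith))
      (Real.rpow_nonneg (powerBarrier_nonneg hm s) _)
  calc powerBarrier α m y = m * (max y 0) ^ 2 * powerBarrier α m y ^ α :=
        (powerBarrier_rpow_mul hα.2 hm y).symm
    _ = ∫ _ in (y / 4)..(y / 2), y / 2 / Λ * Real.exp (-B / Λ) * powerBarrier α m (y / 4) ^ α := by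
        rw [intervalIntegral.integral_const, max_eq_left hy0, smul_eq_mul,
          powerBarrier_quarter hm hy0, Real.mul_rpow (by positivity) (powerBarrier_nonneg hm y),
          ← hκ, hmdef]
        ring
    _ ≤ ∫ s in (y / 4)..(y / 2), (1 - Real.exp (-(y - s) / Λ)) * powerBarrier α m s ^ α := by
        refine intervalIntegral.integral_mono_on (by linarith) (by simp) (hci _ _) fun s hs => ?_
        have h0 := powerBarrier_nonneg (α := α) hm (y / 4)
        refine mul_le_mul ?_ (Real.rpow_le_rpow h0 (powerBarrier_mono hα.2 hm hs.1) hα.1.le)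
          (Real.rpow_nonneg h0 _) (one_sub_exp_nonneg hΛ (by linarith [hs.2]))
        have h1 := Real.add_one_le_exp ((y - s) / Λ)
        have h2 : y / 2 / Λ ≤ (y - s) / Λ := by gcongr; linarith [hs.2]
        have h3 : Real.exp (-B / Λ) ≤ Real.exp (-(y - s) / Λ) :=
          Real.exp_le_exp.2 (by gcongr; linarith [hs.1, hy.2])
        have h4 : Real.exp ((y - s) / Λ) * Real.exp (-(y - s) / Λ) = 1 := by
          rw [← Real.exp_add]; ring_nf; simp
        have h5 : (0 : ℝ) ≤ y / 2 / Λ := by positivity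
        calc y / 2 / Λ * Real.exp (-B / Λ) ≤ (Real.exp ((y - s) / Λ) - 1) *
              Real.exp (-(y - s) / Λ) := by
              refine mul_le_mul (by linarith) h3 (Real.exp_pos _).le (by linarith)
          _ = _ := by linear_combination h4
    _ ≤ volterra Λ (fun s => powerBarrier α m s ^ α) y := by
        rw [volterra]
        refine intervalIntegral.integral_mono_interval (by linarith) (by linarith) (by linarith)
          ?_ (hci _ _)
        refine (MeasureTheory.ae_restrict_iff' measurableSet_Ioc).2 (Eventually.of_forall ?_)
        exact fun s hs => hnn s hs.2

/-! ### Existence of the profile -/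

/-- A positive solution `z` of `Λ z'' + z' = z ^ α`, `z 0 = z' 0 = 0`, on the positive half-line,
with derivative `p`, extended by zero to the negative half-line. It is the reactant profile in the
reflected variable `y = -x`; as the extension is of class `C²`, the equation holds on all of `ℝ`. -/
structure IsReflectedProfile (α Λ : ℝ) (z p : ℝ → ℝ) : Prop where
  hasDerivAt : ∀ y, HasDerivAt z (p y) y
  hasDerivAt_deriv : ∀ y, HasDerivAt p ((z y ^ α - p y) / Λ) y
  of_nonpos : ∀ y ≤ 0, z y = 0
  pos : ∀ y, 0 < y → 0 < z y

/-- The Picard iterates of the Volterra equation, starting from the supersolution. -/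
noncomputable def profileIter (α Λ : ℝ) : ℕ → ℝ → ℝ
  | 0 => powerBarrier α Λ⁻¹
  | n + 1 => volterra Λ fun s => profileIter α Λ n s ^ α

section Existence

variable {α Λ : ℝ}

lemma continuous_profileIter (hα : α ∈ Ioo (0 : ℝ) 1) (n : ℕ) :
    Continuous (profileIter α Λ n) := by
  induction n with
  | zero => exact continuous_powerBarrier hα.2
  | succ n ih =>
    exact continuous_volterra fun a b => (continuous_rpow_of_pos hα.1 ih).intervalIntegrable a b

lemma profileIter_of_nonpos (hα : α ∈ Ioo (0 : ℝ) 1) (n : ℕ) {y : ℝ} (hy : y ≤ 0) :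
    profileIter α Λ n y = 0 := by
  induction n generalizing y with
  | zero => exact powerBarrier_of_nonpos hα.2 hy
  | succ n ih =>
    exact volterra_of_nonpos (fun s hs => by simp [ih hs, Real.zero_rpow hα.1.ne']) hy

lemma profileIter_nonneg (hα : α ∈ Ioo (0 : ℝ) 1) (hΛ : 0 < Λ) (n : ℕ) (y : ℝ) :
    0 ≤ profileIter α Λ n y := by
  rcases le_or_gt y 0 with hy | hy
  · exact (profileIter_of_nonpos hα n hy).ge
  induction n generalizing y with
  | zero => exact powerBarrier_nonneg (by positivity) y
  | succ n ih =>
    refine intervalIntegral.integral_nonneg hy.le fun s hs =>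
      mul_nonneg (one_sub_exp_nonneg hΛ (by linarith [hs.2])) (Real.rpow_nonneg ?_ _)
    rcases hs.1.eq_or_lt with rfl | h
    · exact (profileIter_of_nonpos hα n le_rfl).ge
    · exact ih s h

lemma profileIter_succ_le (hα : α ∈ Ioo (0 : ℝ) 1) (hΛ : 0 < Λ) (n : ℕ) (y : ℝ) :
    profileIter α Λ (n + 1) y ≤ profileIter α Λ n y := by
  rcases le_or_gt y 0 with hy | hy
  · rw [profileIter_of_nonpos hα _ hy, profileIter_of_nonpos hα _ hy]
  induction n generalizing y with
  | zero => exact volterra_le_powerBarrier hα hΛ hy.le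
  | succ n ih =>
    refine volterra_mono hΛ (continuous_rpow_of_pos hα.1 (continuous_profileIter hα _))
      (continuous_rpow_of_pos hα.1 (continuous_profileIter hα _)) hy.le fun s hs => ?_
    refine Real.rpow_le_rpow (profileIter_nonneg hα hΛ _ _) ?_ hα.1.le
    rcases hs.1.eq_or_lt with rfl | h
    · rw [profileIter_of_nonpos hα _ le_rfl, profileIter_of_nonpos hα _ le_rfl]
    · exact ih s h

lemma powerBarrier_le_profileIter (hα : α ∈ Ioo (0 : ℝ) 1) (hΛ : 0 < Λ) {m B : ℝ} (hm : 0 ≤ m)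
    (hmΛ : m ≤ Λ⁻¹) (h : ∀ y ∈ Icc 0 B,
      powerBarrier α m y ≤ volterra Λ (fun s => powerBarrier α m s ^ α) y) (n : ℕ) :
    ∀ y ∈ Icc 0 B, powerBarrier α m y ≤ profileIter α Λ n y := by
  induction n with
  | zero => exact fun y _ => powerBarrier_le_of_le hα.2 hm hmΛ y
  | succ n ih =>
    refine fun y hy => (h y hy).trans ?_
    refine volterra_mono hΛ (continuous_rpow_of_pos hα.1 (continuous_powerBarrier hα.2))
      (continuous_rpow_of_pos hα.1 (continuous_profileIter hα _)) hy.1 fun s hs => ?_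
    exact Real.rpow_le_rpow (powerBarrier_nonneg hm _) (ih s ⟨hs.1, hs.2.trans hy.2⟩) hα.1.le

/-- The profile is the limit of the decreasing sequence of Picard iterates; the subsolutions keep
it away from the trivial solution `0`. -/
theorem exists_isReflectedProfile (hα : α ∈ Ioo (0 : ℝ) 1) (hΛ : 0 < Λ) :
    ∃ z p, IsReflectedProfile α Λ z p := by
  set z : ℝ → ℝ := fun y => ⨅ n, profileIter α Λ n y with hz
  have hbdd : ∀ y, BddBelow (range fun n => profileIter α Λ n y) := fun y =>
    ⟨0, by rintro _ ⟨n, rfl⟩; exact profileIter_nonneg hα hΛ n y⟩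
  have hanti : ∀ y, Antitone fun n => profileIter α Λ n y := fun y =>
    antitone_nat_of_succ_le fun n => profileIter_succ_le hα hΛ n y
  have hlim : ∀ y, Tendsto (fun n => profileIter α Λ n y) atTop (𝓝 (z y)) := fun y =>
    tendsto_atTop_ciInf (hanti y) (hbdd y)
  have hz0 : ∀ y, 0 ≤ z y := fun y => le_ciInf fun n => profileIter_nonneg hα hΛ n y
  have hzle : ∀ y, z y ≤ powerBarrier α Λ⁻¹ y := fun y => ciInf_le (hbdd y) 0
  have hmeas : Measurable z := measurable_of_tendsto_metrizable
    (fun n => (continuous_profileIter hα n).measurable) (tendsto_pi_nhds.2 hlim)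
  have hbc := continuous_rpow_of_pos hα.1 (continuous_powerBarrier (m := Λ⁻¹) hα.2)
  have hint : ∀ a b, IntervalIntegrable (fun s => z s ^ α) MeasureTheory.volume a b := by
    intro a b
    refine (hbc.intervalIntegrable a b).mono_fun (hmeas.pow_const α).aestronglyMeasurable
      (Eventually.of_forall fun s => ?_)
    dsimp only
    rw [Real.norm_of_nonneg (Real.rpow_nonneg (hz0 s) _), Real.norm_of_nonneg
      (Real.rpow_nonneg ((hz0 s).trans (hzle s)) _)]
    exact Real.rpow_le_rpow (hz0 s) (hzle s) hα.1.le
  have hfix : ∀ y, z y = volterra Λ (fun s => z s ^ α) y := by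
    intro y
    refine tendsto_nhds_unique ((hlim y).comp (tendsto_add_atTop_nat 1)) ?_
    refine intervalIntegral.tendsto_integral_filter_of_dominated_convergence
      (fun s => |1 - Real.exp (-(y - s) / Λ)| * powerBarrier α Λ⁻¹ s ^ α) ?_ ?_
      (Continuous.intervalIntegrable (by fun_prop) _ _) ?_
    · refine Eventually.of_forall fun n => Continuous.aestronglyMeasurable ?_
      have := continuous_rpow_of_pos hα.1 (continuous_profileIter (Λ := Λ) hα n)
      fun_prop
    · refine Eventually.of_forall fun n => Eventually.of_forall fun s _ => ?_
      rw [norm_mul, Real.norm_eq_abs, Real.norm_of_nonneg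
        (Real.rpow_nonneg (profileIter_nonneg hα hΛ n s) _)]
      gcongr
      · exact profileIter_nonneg hα hΛ n s
      · exact hα.1.le
      · exact hanti s (Nat.zero_le n)
    · refine Eventually.of_forall fun s _ => Tendsto.const_mul _ ?_
      exact (hlim s).rpow_const (Or.inr hα.1.le)
  have hzc : Continuous z := by rw [funext hfix]; exact continuous_volterra hint
  have hgc := continuous_rpow_of_pos hα.1 hzc
  refine ⟨z, fun y => 1 / Λ * (Real.exp (-y / Λ) *
    ∫ s in (0 : ℝ)..y, Real.exp (s / Λ) * z s ^ α), ?_, ?_, ?_, ?_⟩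
  · intro y
    have := hasDerivAt_volterra (Λ := Λ) hgc y
    rwa [← funext hfix] at this
  · intro y
    have h2 := (show Continuous fun s => Real.exp (s / Λ) * z s ^ α by
      fun_prop).integral_hasStrictDerivAt 0 y |>.hasDerivAt
    have h3 : HasDerivAt (fun y : ℝ => Real.exp (-y / Λ)) (Real.exp (-y / Λ) * (-1 / Λ)) y :=
      ((hasDerivAt_id y).neg.div_const Λ).exp
    refine ((h3.mul h2).const_mul (1 / Λ)).congr_deriv ?_
    have : Real.exp (-y / Λ) * Real.exp (y / Λ) = 1 := by rw [← Real.exp_add]; ring_nf; simp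
    linear_combination (1 / Λ * z y ^ α) * this
  · intro y hy
    simp [hz, profileIter_of_nonpos hα _ hy]
  · intro y hy
    obtain ⟨m, hm, hmΛ, h⟩ := exists_powerBarrier_le_volterra hα hΛ hy.le
    exact (powerBarrier_pos hm hy).trans_le (le_ciInf fun n =>
      powerBarrier_le_profileIter hα hΛ hm.le hmΛ h n y ⟨hy.le, le_rfl⟩)

end Existence

/-! ### The ignition ratio -/

/-- Monotone form of l'Hôpital's rule: by Cauchy's mean value theorem `F x / G x` is a value of
`f / g` at a smaller argument, which fixes the sign of `(F / G)'`. -/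
lemma strictMonoOn_div_of_strictMonoOn_deriv_div {F G f g : ℝ → ℝ} (hF : ContinuousOn F (Ici 0))
    (hG : ContinuousOn G (Ici 0)) (hF0 : F 0 = 0) (hG0 : G 0 = 0)
    (hf : ∀ x, 0 < x → HasDerivAt F (f x) x) (hg : ∀ x, 0 < x → HasDerivAt G (g x) x)
    (hgpos : ∀ x, 0 < x → 0 < g x) (hmono : StrictMonoOn (fun x => f x / g x) (Ioi 0)) :
    StrictMonoOn (fun x => F x / G x) (Ioi 0) := by
  have hGpos : ∀ x, 0 < x → 0 < G x := by
    have hm : StrictMonoOn G (Ici 0) := strictMonoOn_of_deriv_pos (convex_Ici 0) hG fun x hx => by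
      rw [interior_Ici] at hx
      rw [(hg x hx).deriv]; exact hgpos x hx
    intro x hx
    simpa [hG0] using hm (mem_Ici.2 le_rfl) (mem_Ici.2 (le_of_lt hx)) hx
  have hd : ∀ x, 0 < x → HasDerivAt (fun x => F x / G x)
      ((f x * G x - F x * g x) / G x ^ 2) x := fun x hx => (hf x hx).div (hg x hx) (hGpos x hx).ne'
  refine strictMonoOn_of_deriv_pos (convex_Ioi 0)
    (fun x hx => (hd x hx).continuousAt.continuousWithinAt) fun x hx => ?_
  rw [interior_Ioi] at hx
  have hx' : 0 < x := hx
  rw [(hd x hx).deriv]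
  obtain ⟨c, hc, hcs⟩ := exists_ratio_hasDerivAt_eq_ratio_slope F f hx' (hF.mono Icc_subset_Ici_self)
    (fun y hy => hf y hy.1) G g (hG.mono Icc_subset_Ici_self) (fun y hy => hg y hy.1)
  rw [hF0, hG0, sub_zero, sub_zero] at hcs
  have h1 : f c / g c < f x / g x := hmono hc.1 hx hc.2
  rw [div_lt_div_iff₀ (hgpos c hc.1) (hgpos x hx)] at h1
  refine div_pos (sub_pos.2 ?_) (pow_pos (hGpos x hx) 2)
  have h2 : F x * g x * g c < f x * G x * g c := by
    calc F x * g x * g c = G x * (f c * g x) := by linear_combination (-g x) * hcs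
      _ < G x * (f x * g c) := mul_lt_mul_of_pos_left h1 (hGpos x hx)
      _ = _ := by ring
  exact lt_of_mul_lt_mul_right h2 (hgpos c hc.1).le

namespace IsReflectedProfile

variable {α Λ : ℝ} {z p : ℝ → ℝ}

lemma continuous (h : IsReflectedProfile α Λ z p) : Continuous z :=
  continuous_iff_continuousAt.2 fun y => (h.hasDerivAt y).continuousAt

lemma continuous_deriv (h : IsReflectedProfile α Λ z p) : Continuous p :=
  continuous_iff_continuousAt.2 fun y => (h.hasDerivAt_deriv y).continuousAt

lemma nonneg (h : IsReflectedProfile α Λ z p) (y : ℝ) : 0 ≤ z y := by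
  rcases le_or_gt y 0 with hy | hy
  · exact (h.of_nonpos y hy).ge
  · exact (h.pos y hy).le

lemma deriv_of_nonpos (h : IsReflectedProfile α Λ z p) {y : ℝ} (hy : y ≤ 0) : p y = 0 := by
  have hneg : ∀ y ∈ Iio (0 : ℝ), p y = 0 := fun y hy =>
    (h.hasDerivAt y).unique ((hasDerivAt_const y (0 : ℝ)).congr_of_eventuallyEq <| by
      filter_upwards [Iio_mem_nhds hy] with x hx using h.of_nonpos x (le_of_lt hx))
  have hcl : closure (Iio (0 : ℝ)) ⊆ {y | p y = 0} :=
    closure_minimal hneg (isClosed_eq h.continuous_deriv continuous_const)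
  rw [closure_Iio] at hcl
  exact hcl hy

lemma continuous_rpow (h : IsReflectedProfile α Λ z p) (hα : 0 < α) :
    Continuous fun s => z s ^ α := continuous_rpow_of_pos hα h.continuous

lemma deriv_pos (h : IsReflectedProfile α Λ z p) (hΛ : 0 < Λ) {y : ℝ} (hy : 0 < y) : 0 < p y := by
  have hd : ∀ x, HasDerivAt (fun x => Real.exp (x / Λ) * p x)
      (Real.exp (x / Λ) * z x ^ α / Λ) x := fun x => by
    refine ((((hasDerivAt_id x).div_const Λ).exp).mul (h.hasDerivAt_deriv x)).congr_deriv ?_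
    simp only [id]; ring
  have hm : StrictMonoOn (fun x => Real.exp (x / Λ) * p x) (Ici 0) :=
    strictMonoOn_of_deriv_pos (convex_Ici 0)
      (fun x _ => (hd x).continuousAt.continuousWithinAt) fun x hx => by
        rw [interior_Ici] at hx
        have := h.pos x hx
        rw [(hd x).deriv]; positivity
  have := hm (mem_Ici.2 le_rfl) (mem_Ici.2 hy.le) hy
  simp only [h.deriv_of_nonpos le_rfl, mul_zero] at this
  exact pos_of_mul_pos_right this (Real.exp_pos _).le

lemma strictMonoOn (h : IsReflectedProfile α Λ z p) (hΛ : 0 < Λ) : StrictMonoOn z (Ici 0) :=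
  strictMonoOn_of_deriv_pos (convex_Ici 0) h.continuous.continuousOn fun x hx => by
    rw [interior_Ici] at hx
    rw [(h.hasDerivAt x).deriv]; exact h.deriv_pos hΛ hx

/-- Strict log-concavity of the profile. The equation gives
`(exp (y / Λ) * (z z'' - z' ^ 2))' = -(1 - α) / Λ * exp (y / Λ) * z ^ α * z' < 0`. -/
lemma mul_deriv_deriv_lt_sq (h : IsReflectedProfile α Λ z p) (hα : α ∈ Ioo (0 : ℝ) 1)
    (hΛ : 0 < Λ) {y : ℝ} (hy : 0 < y) : z y * ((z y ^ α - p y) / Λ) < p y ^ 2 := by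
  set D : ℝ → ℝ := fun x => Real.exp (x / Λ) * (z x * ((z x ^ α - p x) / Λ) - p x ^ 2) with hD
  have hd : ∀ x, 0 < x → HasDerivAt D
      (Real.exp (x / Λ) * ((α - 1) * (z x ^ α * p x) / Λ)) x := fun x hx => by
    have hz := h.pos x hx
    have h1 := h.hasDerivAt x
    have h2 := h.hasDerivAt_deriv x
    have h3 : HasDerivAt (fun x => z x ^ α) (p x * α * z x ^ (α - 1)) x :=
      h1.rpow_const (Or.inl hz.ne')
    refine ((((hasDerivAt_id x).div_const Λ).exp).mul
      ((h1.mul ((h3.sub h2).div_const Λ)).sub (h2.pow 2))).congr_deriv ?_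
    rw [Real.rpow_sub_one hz.ne']
    simp only [id, Pi.sub_apply, Pi.mul_apply, Pi.pow_apply]
    field_simp
    ring
  have hm : StrictAntiOn D (Ici 0) := by
    have hc := h.continuous
    have hc1 := h.continuous_rpow hα.1
    have hc2 := h.continuous_deriv
    refine strictAntiOn_of_deriv_neg (convex_Ici 0) (Continuous.continuousOn (by fun_prop))
      fun x hx => ?_
    rw [interior_Ici] at hx
    have h1 := h.deriv_pos hΛ hx
    have h2 := Real.rpow_pos_of_pos (h.pos x hx) α
    rw [(hd x hx).deriv]
    refine mul_neg_of_pos_of_neg (Real.exp_pos _) (div_neg_of_neg_of_pos ?_ hΛ)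
    exact mul_neg_of_neg_of_pos (by linarith [hα.2]) (by positivity)
  have := hm (mem_Ici.2 le_rfl) (mem_Ici.2 hy.le) hy
  simp only [hD, h.deriv_of_nonpos le_rfl, h.of_nonpos 0 le_rfl] at this
  simp only [zero_mul, ne_eq, OfNat.ofNat_ne_zero, not_false_eq_true, zero_pow, sub_zero,
    mul_zero] at this
  have := neg_of_mul_neg_right this (Real.exp_pos _).le
  linarith

lemma strictMonoOn_div_deriv (h : IsReflectedProfile α Λ z p) (hα : α ∈ Ioo (0 : ℝ) 1)
    (hΛ : 0 < Λ) : StrictMonoOn (fun y => z y / p y) (Ioi 0) := by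
  have hd : ∀ y, 0 < y → HasDerivAt (fun y => z y / p y)
      ((p y * p y - z y * ((z y ^ α - p y) / Λ)) / p y ^ 2) y := fun y hy =>
    (h.hasDerivAt y).div (h.hasDerivAt_deriv y) (h.deriv_pos hΛ hy).ne'
  refine strictMonoOn_of_deriv_pos (convex_Ioi 0)
    (fun x hx => (hd x hx).continuousAt.continuousWithinAt) fun y hy => ?_
  rw [interior_Ioi] at hy
  rw [(hd y hy).deriv]
  have := h.mul_deriv_deriv_lt_sq hα hΛ hy
  exact div_pos (by linarith) (pow_pos (h.deriv_pos hΛ hy) 2)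

lemma hasDerivAt_integral (h : IsReflectedProfile α Λ z p) (hα : 0 < α) (y : ℝ) :
    HasDerivAt (fun y => ∫ t in (0 : ℝ)..y, z t ^ α) (z y ^ α) y :=
  ((h.continuous_rpow hα).integral_hasStrictDerivAt 0 y).hasDerivAt

lemma integral_rpow_pos (h : IsReflectedProfile α Λ z p) (hα : 0 < α) {y : ℝ} (hy : 0 < y) :
    0 < ∫ t in (0 : ℝ)..y, z t ^ α :=
  intervalIntegral.intervalIntegral_pos_of_pos_on ((h.continuous_rpow hα).intervalIntegrable _ _)
    (fun x hx => Real.rpow_pos_of_pos (h.pos x hx.1) _) hy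

/-- `I / I'` is increasing for `I = ∫ z ^ α`: this follows from log-concavity, since `I' / I''` is
the increasing function `z / (α z')`. -/
lemma strictMonoOn_integral_div (h : IsReflectedProfile α Λ z p) (hα : α ∈ Ioo (0 : ℝ) 1)
    (hΛ : 0 < Λ) : StrictMonoOn (fun y => (∫ t in (0 : ℝ)..y, z t ^ α) / z y ^ α) (Ioi 0) := by
  refine strictMonoOn_div_of_strictMonoOn_deriv_div (f := fun y => z y ^ α)
    (g := fun y => p y * α * z y ^ (α - 1))
    (fun y _ => (h.hasDerivAt_integral hα.1 y).continuousAt.continuousWithinAt)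
    (h.continuous_rpow hα.1).continuousOn (by simp)
    (by simp [h.of_nonpos 0 le_rfl, Real.zero_rpow hα.1.ne'])
    (fun y _ => h.hasDerivAt_integral hα.1 y)
    (fun y hy => (h.hasDerivAt y).rpow_const (Or.inl (h.pos y hy).ne'))
    (fun y hy => ?_) ?_
  · have h1 := h.deriv_pos hΛ hy
    have h2 := Real.rpow_pos_of_pos (h.pos y hy) (α - 1)
    have := hα.1
    positivity
  · have hs : StrictMonoOn (fun y => z y / p y * α⁻¹) (Ioi 0) := fun x hx y hy hxy =>
      mul_lt_mul_of_pos_right (h.strictMonoOn_div_deriv hα hΛ hx hy hxy) (inv_pos.2 hα.1)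
    refine hs.congr fun y hy => ?_
    have h1 := h.deriv_pos hΛ hy
    have h2 := h.pos y hy
    have h3 := (Real.rpow_pos_of_pos h2 α).ne'
    have h4 := hα.1.ne'
    simp only
    rw [Real.rpow_sub_one h2.ne']
    field_simp

lemma ignitionRatio_eq (x : ℝ) :
    ignitionRatio α (fun x => z (-x)) x =
      (∫ t in (0 : ℝ)..x, Real.exp t * z t ^ α) / (Real.exp x * ∫ t in (0 : ℝ)..x, z t ^ α) := by
  have h1 : ∫ s in (-x)..0, z (-s) ^ α = ∫ t in (0 : ℝ)..x, z t ^ α := by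
    simpa using intervalIntegral.integral_comp_neg (a := -x) (b := 0) fun t => z t ^ α
  have h2 : ∫ s in (-x)..0, z (-s) ^ α * Real.exp (-(s + x)) =
      Real.exp (-x) * ∫ t in (0 : ℝ)..x, Real.exp t * z t ^ α := by
    rw [← intervalIntegral.integral_const_mul]
    have := intervalIntegral.integral_comp_neg (a := -x) (b := 0)
      fun t => Real.exp (-x) * (Real.exp t * z t ^ α)
    rw [neg_zero, neg_neg] at this
    rw [← this]
    refine intervalIntegral.integral_congr fun s _ => ?_
    simp only [neg_add, Real.exp_add]; ring
  rw [ignitionRatio, h1, h2, Real.exp_neg]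
  field_simp

lemma hasDerivAt_integral_exp_mul (h : IsReflectedProfile α Λ z p) (hα : 0 < α) (y : ℝ) :
    HasDerivAt (fun y => ∫ t in (0 : ℝ)..y, Real.exp t * z t ^ α) (Real.exp y * z y ^ α) y := by
  have := h.continuous_rpow hα
  exact ((show Continuous fun t => Real.exp t * z t ^ α by
    fun_prop).integral_hasStrictDerivAt 0 y).hasDerivAt

/-- The ratio of the derivatives of numerator and denominator is `I' / (I' + I)`. -/
lemma strictAntiOn_ignitionRatio (h : IsReflectedProfile α Λ z p) (hα : α ∈ Ioo (0 : ℝ) 1)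
    (hΛ : 0 < Λ) : StrictAntiOn (ignitionRatio α fun x => z (-x)) (Ioi 0) := by
  have key : StrictMonoOn (fun x => (-∫ t in (0 : ℝ)..x, Real.exp t * z t ^ α) /
      (Real.exp x * ∫ t in (0 : ℝ)..x, z t ^ α)) (Ioi 0) := by
    refine strictMonoOn_div_of_strictMonoOn_deriv_div
      (f := fun y => -(Real.exp y * z y ^ α))
      (g := fun y => Real.exp y * (∫ t in (0 : ℝ)..y, z t ^ α) + Real.exp y * z y ^ α)
      (fun y _ => (h.hasDerivAt_integral_exp_mul hα.1 y).neg.continuousAt.continuousWithinAt)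
      (fun y _ => ((Real.hasDerivAt_exp y).mul
        (h.hasDerivAt_integral hα.1 y)).continuousAt.continuousWithinAt)
      (by simp) (by simp)
      (fun y _ => (h.hasDerivAt_integral_exp_mul hα.1 y).neg)
      (fun y _ => (Real.hasDerivAt_exp y).mul (h.hasDerivAt_integral hα.1 y))
      (fun y hy => ?_) fun x hx y hy hxy => ?_
    · have := h.integral_rpow_pos hα.1 hy
      have := Real.rpow_pos_of_pos (h.pos y hy) α
      positivity
    · have hI := h.strictMonoOn_integral_div hα hΛ hx hy hxy
      have e : ∀ y, 0 < y → -(Real.exp y * z y ^ α) / (Real.exp y *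
          (∫ t in (0 : ℝ)..y, z t ^ α) + Real.exp y * z y ^ α) =
          -(1 / ((∫ t in (0 : ℝ)..y, z t ^ α) / z y ^ α + 1)) := fun y hy => by
        have h1 := h.integral_rpow_pos hα.1 hy
        have h2 := Real.rpow_pos_of_pos (h.pos y hy) α
        field_simp
      simp only
      rw [e x hx, e y hy, neg_lt_neg_iff]
      have h1 := h.integral_rpow_pos hα.1 hx
      have h2 := Real.rpow_pos_of_pos (h.pos x hx) α
      exact one_div_lt_one_div_of_lt (by positivity) (by simpa using hI)
  intro x hx y hy hxy
  have := key hx hy hxy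
  simp only [neg_div, neg_lt_neg_iff] at this
  rwa [ignitionRatio_eq, ignitionRatio_eq]

lemma ignitionRatio_pos (h : IsReflectedProfile α Λ z p) (hα : 0 < α) {x : ℝ} (hx : 0 < x) :
    0 < ignitionRatio α (fun x => z (-x)) x := by
  rw [ignitionRatio_eq]
  have hc := h.continuous_rpow hα
  refine div_pos (intervalIntegral.intervalIntegral_pos_of_pos_on
    (Continuous.intervalIntegrable (by fun_prop) _ _)
    (fun t ht => ?_) hx) (mul_pos (Real.exp_pos _) (h.integral_rpow_pos hα hx))
  have := Real.rpow_pos_of_pos (h.pos t ht.1) α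
  positivity

lemma ignitionRatio_lt_one (h : IsReflectedProfile α Λ z p) (hα : 0 < α) {x : ℝ} (hx : 0 < x) :
    ignitionRatio α (fun x => z (-x)) x < 1 := by
  have hc := h.continuous_rpow hα
  rw [ignitionRatio_eq, div_lt_one (mul_pos (Real.exp_pos _) (h.integral_rpow_pos hα hx)),
    ← intervalIntegral.integral_const_mul, ← sub_pos, ← intervalIntegral.integral_sub
      (Continuous.intervalIntegrable (by fun_prop) _ _)
      (Continuous.intervalIntegrable (by fun_prop) _ _)]
  refine intervalIntegral.intervalIntegral_pos_of_pos_on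
    (Continuous.intervalIntegrable (by fun_prop) _ _) (fun t ht => ?_) hx
  have := Real.rpow_pos_of_pos (h.pos t ht.1) α
  rw [← sub_mul]
  exact mul_pos (sub_pos.2 (Real.exp_lt_exp.2 ht.2)) this

lemma exp_neg_lt_ignitionRatio (h : IsReflectedProfile α Λ z p) (hα : 0 < α) {x : ℝ}
    (hx : 0 < x) : Real.exp (-x) < ignitionRatio α (fun x => z (-x)) x := by
  have hc := h.continuous_rpow hα
  rw [ignitionRatio_eq, lt_div_iff₀ (mul_pos (Real.exp_pos _) (h.integral_rpow_pos hα hx)),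
    ← mul_assoc, ← Real.exp_add, neg_add_cancel, Real.exp_zero, one_mul,
    ← sub_pos, ← intervalIntegral.integral_sub
      (Continuous.intervalIntegrable (by fun_prop) _ _)
      (Continuous.intervalIntegrable (by fun_prop) _ _)]
  refine intervalIntegral.intervalIntegral_pos_of_pos_on
    (Continuous.intervalIntegrable (by fun_prop) _ _) (fun t ht => ?_) hx
  have := Real.rpow_pos_of_pos (h.pos t ht.1) α
  rw [← sub_one_mul]
  exact mul_pos (sub_pos.2 (Real.one_lt_exp_iff.2 ht.1)) this

/-- The first integral of the equation, `Λ z' + z = ∫ z ^ α`. -/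
lemma first_integral (h : IsReflectedProfile α Λ z p) (hα : 0 < α) (hΛ : 0 < Λ) {y : ℝ}
    (hy : 0 ≤ y) : ∫ t in (0 : ℝ)..y, z t ^ α = Λ * p y + z y := by
  rw [intervalIntegral.integral_eq_sub_of_hasDerivAt_of_le (f := fun y => Λ * p y + z y) hy]
  · simp [h.deriv_of_nonpos le_rfl, h.of_nonpos 0 le_rfl]
  · have := h.continuous
    have := h.continuous_deriv
    fun_prop
  · refine fun x _ => (((h.hasDerivAt_deriv x).const_mul Λ).add (h.hasDerivAt x)).congr_deriv ?_
    field_simp; ring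
  · exact (h.continuous_rpow hα).intervalIntegrable _ _

/-- As `z ≤ I` by the first integral, the ignition ratio is at most `z ^ α / I ≤ I ^ (α - 1)`, and
`I` grows at least linearly. -/
lemma exists_ignitionRatio_lt (h : IsReflectedProfile α Λ z p) (hα : α ∈ Ioo (0 : ℝ) 1)
    (hΛ : 0 < Λ) {ε : ℝ} (hε : 0 < ε) : ∃ x, 0 < x ∧ ignitionRatio α (fun x => z (-x)) x < ε := by
  have hc := h.continuous_rpow hα.1
  set I : ℝ → ℝ := fun x => ∫ t in (0 : ℝ)..x, z t ^ α with hI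
  have hfm : ∀ s t, 0 ≤ s → s ≤ t → z s ^ α ≤ z t ^ α := fun s t hs hst =>
    Real.rpow_le_rpow (h.nonneg s) ((h.strictMonoOn hΛ).monotoneOn hs (hs.trans hst) hst) hα.1.le
  have hlin : ∀ x, 1 ≤ x → z 1 ^ α * (x - 1) ≤ I x := fun x hx => by
    calc z 1 ^ α * (x - 1) = ∫ _ in (1 : ℝ)..x, z 1 ^ α := by simp [mul_comm]
      _ ≤ ∫ t in (1 : ℝ)..x, z t ^ α := intervalIntegral.integral_mono_on hx (by simp)
          (hc.intervalIntegrable _ _) fun t ht => hfm 1 t zero_le_one ht.1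
      _ ≤ I x := by
        refine intervalIntegral.integral_mono_interval zero_le_one hx le_rfl
          (Eventually.of_forall fun t => Real.rpow_nonneg (h.nonneg t) _)
          (hc.intervalIntegrable _ _)
  have hIt : Tendsto I atTop atTop := by
    refine tendsto_atTop_mono' _ ((eventually_ge_atTop 1).mono hlin) ?_
    exact (tendsto_atTop_add_const_right _ (-1) tendsto_id).const_mul_atTop
      (Real.rpow_pos_of_pos (h.pos 1 one_pos) α)
  have ht : Tendsto (fun x => I x ^ (-(1 - α))) atTop (𝓝 0) :=
    (tendsto_rpow_neg_atTop (by linarith [hα.2])).comp hIt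
  obtain ⟨x, hx, hx0⟩ := ((ht.eventually (Iio_mem_nhds hε)).and (eventually_gt_atTop 0)).exists
  have hIpos : 0 < I x := h.integral_rpow_pos hα.1 hx0
  refine ⟨x, hx0, lt_of_le_of_lt ?_ hx⟩
  have hzI : z x ≤ I x := by
    have := h.first_integral hα.1 hΛ hx0.le
    have := mul_pos hΛ (h.deriv_pos hΛ hx0)
    simp only [hI]; linarith
  rw [ignitionRatio_eq, div_le_iff₀ (by positivity)]
  calc ∫ t in (0 : ℝ)..x, Real.exp t * z t ^ α ≤ ∫ t in (0 : ℝ)..x, Real.exp t * z x ^ α :=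
        intervalIntegral.integral_mono_on hx0.le (Continuous.intervalIntegrable (by fun_prop) _ _)
          (Continuous.intervalIntegrable (by fun_prop) _ _) fun t ht =>
          mul_le_mul_of_nonneg_left (hfm t x ht.1 ht.2) (Real.exp_pos _).le
    _ = (Real.exp x - 1) * z x ^ α := by
        rw [intervalIntegral.integral_mul_const, integral_exp, Real.exp_zero]
    _ ≤ Real.exp x * I x ^ α := by
        refine mul_le_mul (by linarith) (Real.rpow_le_rpow (h.nonneg x) hzI hα.1.le)
          (Real.rpow_nonneg (h.nonneg x) _) (Real.exp_pos _).le
    _ = I x ^ (-(1 - α)) * (Real.exp x * I x) := by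
        rw [show I x ^ α = I x ^ (-(1 - α)) * I x by
          rw [← Real.rpow_add_one hIpos.ne']; congr 1; ring]
        ring

lemma bijOn_ignitionRatio (h : IsReflectedProfile α Λ z p) (hα : α ∈ Ioo (0 : ℝ) 1)
    (hΛ : 0 < Λ) : BijOn (ignitionRatio α fun x => z (-x)) (Ioi 0) (Ioo 0 1) := by
  refine ⟨fun x hx => ⟨h.ignitionRatio_pos hα.1 hx, h.ignitionRatio_lt_one hα.1 hx⟩,
    (h.strictAntiOn_ignitionRatio hα hΛ).injOn, fun θ hθ => ?_⟩
  have hcont : ContinuousOn (ignitionRatio α fun x => z (-x)) (Ioi 0) := by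
    rw [funext (ignitionRatio_eq (α := α) (z := z))]
    intro x hx
    refine ContinuousAt.continuousWithinAt ?_
    exact (h.hasDerivAt_integral_exp_mul hα.1 x).continuousAt.div
      (Real.continuous_exp.continuousAt.mul (h.hasDerivAt_integral hα.1 x).continuousAt)
      (mul_pos (Real.exp_pos _) (h.integral_rpow_pos hα.1 hx)).ne'
  obtain ⟨x₁, hx₁, h₁⟩ := h.exists_ignitionRatio_lt hα hΛ hθ.1
  have hlog : 0 < -Real.log θ := neg_pos.2 (Real.log_neg hθ.1 hθ.2)
  have h₂ := h.exp_neg_lt_ignitionRatio hα.1 hlog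
  rw [neg_neg, Real.exp_log hθ.1] at h₂
  exact isPreconnected_Ioi.intermediate_value hx₁ hlog hcont ⟨h₁.le, h₂.le⟩

end IsReflectedProfile

/-! ### Uniqueness of the reactant -/

section LinearEquation

variable {κ R : ℝ} {f p g : ℝ → ℝ}

lemma uIcc_subset_Icc_neg_zero {ξ : ℝ} (hξ : ξ ∈ Icc (-R) 0) : uIcc ξ 0 ⊆ Icc (-R) 0 := by
  rw [uIcc_of_le hξ.2]; exact Icc_subset_Icc_left hξ.1

/-- First integral of `f'' - κ f' = g` with `f' 0 = 0`. -/
lemma deriv_sub_mul_eq (hf : ContinuousOn f (Icc (-R) 0)) (hp : ContinuousOn p (Icc (-R) 0))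
    (hg : ContinuousOn g (Icc (-R) 0)) (hfp : ∀ x ∈ Ioo (-R) 0, HasDerivAt f (p x) x)
    (hpg : ∀ x ∈ Ioo (-R) 0, HasDerivAt p (κ * p x + g x) x) (hp0 : p 0 = 0)
    {ξ : ℝ} (hξ : ξ ∈ Icc (-R) 0) :
    p ξ - κ * f ξ = -(κ * f 0) - ∫ s in ξ..0, g s := by
  have hsub := Icc_subset_Icc_left (b := (0 : ℝ)) hξ.1
  rw [intervalIntegral.integral_eq_sub_of_hasDerivAt_of_le (f := fun x => p x - κ * f x) hξ.2]
  · simp only [hp0]; ring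
  · exact (hp.mono hsub).sub (continuousOn_const.mul (hf.mono hsub))
  · intro x hx
    have hx' : x ∈ Ioo (-R) 0 := ⟨hξ.1.trans_lt hx.1, hx.2⟩
    exact ((hpg x hx').sub ((hfp x hx').const_mul κ)).congr_deriv (by ring)
  · exact (hg.mono (uIcc_subset_Icc_neg_zero hξ)).intervalIntegrable

lemma deriv_eq_integral_exp (hp : ContinuousOn p (Icc (-R) 0)) (hg : ContinuousOn g (Icc (-R) 0))
    (hpg : ∀ x ∈ Ioo (-R) 0, HasDerivAt p (κ * p x + g x) x) (hp0 : p 0 = 0)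
    {ξ : ℝ} (hξ : ξ ∈ Icc (-R) 0) :
    p ξ = -∫ s in ξ..0, Real.exp (κ * (ξ - s)) * g s := by
  have hsub := Icc_subset_Icc_left (b := (0 : ℝ)) hξ.1
  rw [intervalIntegral.integral_eq_sub_of_hasDerivAt_of_le
    (f := fun x => Real.exp (κ * (ξ - x)) * p x) hξ.2]
  · simp [hp0]
  · exact (Continuous.continuousOn (by fun_prop)).mul (hp.mono hsub)
  · intro x hx
    have hx' : x ∈ Ioo (-R) 0 := ⟨hξ.1.trans_lt hx.1, hx.2⟩
    refine (((((hasDerivAt_id x).const_sub ξ).const_mul κ).exp).mul (hpg x hx')).congr_deriv ?_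
    simp only [id]; ring
  · exact ContinuousOn.intervalIntegrable ((Continuous.continuousOn (by fun_prop)).mul
      (hg.mono (uIcc_subset_Icc_neg_zero hξ)))

lemma mul_eq_integral (hf : ContinuousOn f (Icc (-R) 0)) (hp : ContinuousOn p (Icc (-R) 0))
    (hg : ContinuousOn g (Icc (-R) 0)) (hfp : ∀ x ∈ Ioo (-R) 0, HasDerivAt f (p x) x)
    (hpg : ∀ x ∈ Ioo (-R) 0, HasDerivAt p (κ * p x + g x) x) (hp0 : p 0 = 0)
    {ξ : ℝ} (hξ : ξ ∈ Icc (-R) 0) :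
    κ * f ξ = κ * f 0 + ∫ s in ξ..0, (1 - Real.exp (κ * (ξ - s))) * g s := by
  have hg' := hg.mono (uIcc_subset_Icc_neg_zero hξ)
  have he : ContinuousOn (fun s => Real.exp (κ * (ξ - s)) * g s) (uIcc ξ 0) :=
    (Continuous.continuousOn (by fun_prop)).mul hg'
  simp only [sub_mul, one_mul]
  rw [intervalIntegral.integral_sub hg'.intervalIntegrable he.intervalIntegrable]
  linear_combination deriv_eq_integral_exp hp hg hpg hp0 hξ -
    deriv_sub_mul_eq hf hp hg hfp hpg hp0 hξ

end LinearEquation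

section Comparison

variable {α R : ℝ} {K v₁ v₂ : ℝ → ℝ}

/-- The equation `v = ∫ K v ^ α` is translation invariant and its kernel is positive, so a solution
translated by `ε` to the right stays strictly above an untranslated one: at the contact point
closest to `0` the two integral formulas contradict each other. -/
lemma lt_shift_of_volterra (hα : 0 < α) (hK : Continuous K) (hKpos : ∀ t, 0 < t → 0 < K t)
    (h₁ : ContinuousOn v₁ (Icc (-R) 0)) (h₂ : ContinuousOn v₂ (Icc (-R) 0))
    (hpos₁ : ∀ x ∈ Ioo (-R) 0, 0 < v₁ x) (hpos₂ : ∀ x ∈ Ioo (-R) 0, 0 < v₂ x)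
    (he₁ : ∀ ξ ∈ Icc (-R) 0, v₁ ξ = ∫ s in ξ..0, K (s - ξ) * v₁ s ^ α)
    (he₂ : ∀ ξ ∈ Icc (-R) 0, v₂ ξ = ∫ s in ξ..0, K (s - ξ) * v₂ s ^ α)
    {ε : ℝ} (hε : 0 < ε) {ξ : ℝ} (hξ : ξ ∈ Icc (-R + ε) 0) : v₂ ξ < v₁ (ξ - ε) := by
  by_contra! hcon
  have hmaps : MapsTo (fun x => x - ε) (Icc (-R + ε) ε) (Icc (-R) 0) := fun x hx =>
    ⟨by linarith [hx.1], by linarith [hx.2]⟩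
  have hs₁ : ContinuousOn (fun x => v₁ (x - ε)) (Icc (-R + ε) ε) :=
    h₁.comp (by fun_prop) hmaps
  have hcl : IsClosed {x ∈ Icc (-R + ε) 0 | v₁ (x - ε) ≤ v₂ x} :=
    isClosed_Icc.isClosed_le (hs₁.mono (Icc_subset_Icc_right hε.le))
      (h₂.mono (Icc_subset_Icc_left (by linarith)))
  obtain ⟨x₀, ⟨hx₀, hle⟩, hmax⟩ := (isCompact_Icc.of_isClosed_subset hcl
    (sep_subset _ _)).exists_isGreatest ⟨ξ, hξ, hcon⟩
  have hlt : ∀ s ∈ Ioc x₀ 0, v₂ s < v₁ (s - ε) := fun s hs => by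
    by_contra! h
    exact absurd (hmax ⟨⟨hx₀.1.trans hs.1.le, hs.2⟩, h⟩) (not_le.2 hs.1)
  have hci : ContinuousOn (fun s => K (s - x₀) * v₁ (s - ε) ^ α) (Icc (-R + ε) ε) :=
    (Continuous.continuousOn (by fun_prop)).mul (hs₁.rpow_const fun _ _ => Or.inr hα.le)
  have hi1 : IntervalIntegrable (fun s => K (s - x₀) * v₁ (s - ε) ^ α) MeasureTheory.volume x₀ 0 :=
    (hci.mono (by rw [uIcc_of_le hx₀.2]; exact Icc_subset_Icc hx₀.1 hε.le)).intervalIntegrable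
  have hi2 : IntervalIntegrable (fun s => K (s - x₀) * v₁ (s - ε) ^ α) MeasureTheory.volume 0 ε :=
    (hci.mono (by
      rw [uIcc_of_le hε.le]
      exact Icc_subset_Icc_left (hx₀.1.trans hx₀.2))).intervalIntegrable
  have e₁ : v₁ (x₀ - ε) = (∫ s in x₀..0, K (s - x₀) * v₁ (s - ε) ^ α) +
      ∫ s in (0 : ℝ)..ε, K (s - x₀) * v₁ (s - ε) ^ α := by
    rw [intervalIntegral.integral_add_adjacent_intervals hi1 hi2,
      he₁ _ ⟨by linarith [hx₀.1], by linarith [hx₀.2]⟩]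
    have := intervalIntegral.integral_comp_sub_right (a := x₀) (b := ε)
      (fun s => K (s - (x₀ - ε)) * v₁ s ^ α) ε
    rw [sub_self] at this
    rw [← this]
    refine intervalIntegral.integral_congr fun s _ => ?_
    simp
  have hpos : 0 < ∫ s in (0 : ℝ)..ε, K (s - x₀) * v₁ (s - ε) ^ α := by
    refine intervalIntegral.intervalIntegral_pos_of_pos_on hi2 (fun s hs => ?_) hε
    refine mul_pos (hKpos _ (by linarith [hs.1, hx₀.2])) (Real.rpow_pos_of_pos (hpos₁ _ ?_) _)
    exact ⟨by linarith [hs.1, hx₀.1, hx₀.2], by linarith [hs.2]⟩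
  have hxR : x₀ ∈ Icc (-R) 0 := ⟨by linarith [hx₀.1], hx₀.2⟩
  have hle2 : v₂ x₀ ≤ ∫ s in x₀..0, K (s - x₀) * v₁ (s - ε) ^ α := by
    rw [he₂ x₀ hxR]
    refine intervalIntegral.integral_mono_on_of_le_Ioo hx₀.2 ?_ hi1 fun s hs => ?_
    · exact ((Continuous.continuousOn (by fun_prop)).mul ((h₂.mono
        (uIcc_subset_Icc_neg_zero hxR)).rpow_const fun _ _ => Or.inr hα.le)).intervalIntegrable
    · refine mul_le_mul_of_nonneg_left ?_ (hKpos _ (by linarith [hs.1])).le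
      exact Real.rpow_le_rpow (hpos₂ s ⟨hxR.1.trans_lt hs.1, hs.2⟩).le
        (hlt s ⟨hs.1, hs.2.le⟩).le hα.le
  linarith

/-- Positive solutions are unique although the nonlinearity `v ^ α` is not Lipschitz at `0`: let
`ε → 0` in `lt_shift_of_volterra`. -/
lemma eqOn_of_volterra (hα : 0 < α) (hK : Continuous K) (hKpos : ∀ t, 0 < t → 0 < K t)
    (hR : 0 < R) (h₁ : ContinuousOn v₁ (Icc (-R) 0)) (h₂ : ContinuousOn v₂ (Icc (-R) 0))
    (hpos₁ : ∀ x ∈ Ioo (-R) 0, 0 < v₁ x) (hpos₂ : ∀ x ∈ Ioo (-R) 0, 0 < v₂ x)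
    (he₁ : ∀ ξ ∈ Icc (-R) 0, v₁ ξ = ∫ s in ξ..0, K (s - ξ) * v₁ s ^ α)
    (he₂ : ∀ ξ ∈ Icc (-R) 0, v₂ ξ = ∫ s in ξ..0, K (s - ξ) * v₂ s ^ α) :
    EqOn v₁ v₂ (Icc (-R) 0) := by
  have hlim : ∀ {v : ℝ → ℝ}, ContinuousOn v (Icc (-R) 0) → ∀ ξ ∈ Ioo (-R) 0,
      Tendsto (fun ε => v (ξ - ε)) (𝓝[>] 0) (𝓝 (v ξ)) := fun {v} hv ξ hξ => by
    have hc : ContinuousAt v (ξ - 0) := by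
      rw [sub_zero]; exact hv.continuousAt (Icc_mem_nhds hξ.1 hξ.2)
    have h2 : ContinuousAt (fun ε => ξ - ε) (0 : ℝ) := by fun_prop
    have := (ContinuousAt.comp (f := fun ε => ξ - ε) hc h2).tendsto.mono_left
      (nhdsWithin_le_nhds (s := Ioi 0))
    simpa [Function.comp_def] using this
  have hev : ∀ ξ ∈ Ioo (-R) 0, ∀ᶠ ε in 𝓝[>] (0 : ℝ), 0 < ε ∧ ξ ∈ Icc (-R + ε) 0 := fun ξ hξ => by
    filter_upwards [Ioo_mem_nhdsGT (show (0 : ℝ) < ξ + R by linarith [hξ.1])] with ε hε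
    exact ⟨hε.1, by linarith [hε.2], hξ.2.le⟩
  refine EqOn.of_subset_closure (s := Ioo (-R) 0) (fun ξ hξ => le_antisymm ?_ ?_) h₁ h₂
    Ioo_subset_Icc_self (by rw [closure_Ioo (by linarith)])
  · exact ge_of_tendsto (hlim h₂ ξ hξ) ((hev ξ hξ).mono fun ε hε =>
      (lt_shift_of_volterra hα hK hKpos h₂ h₁ hpos₂ hpos₁ he₂ he₁ hε.1 hε.2).le)
  · exact ge_of_tendsto (hlim h₁ ξ hξ) ((hev ξ hξ).mono fun ε hε =>
      (lt_shift_of_volterra hα hK hKpos h₁ h₂ hpos₁ hpos₂ he₁ he₂ hε.1 hε.2).le)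

end Comparison

/-- The part of the free-boundary problem that involves only the reactant: a positive solution `v`
of `Λ v'' - c v' = v ^ α` on `(-R, 0)`, with derivative `p` continuous up to the end points, such
that `v 0 = v' 0 = 0`. -/
structure IsZoneReactant (α Λ c R : ℝ) (v p : ℝ → ℝ) : Prop where
  continuousOn : ContinuousOn v (Icc (-R) 0)
  continuousOn_deriv : ContinuousOn p (Icc (-R) 0)
  hasDerivAt : ∀ ξ ∈ Ioo (-R) 0, HasDerivAt v (p ξ) ξ
  hasDerivAt_deriv : ∀ ξ ∈ Ioo (-R) 0, HasDerivAt p ((v ξ ^ α + c * p ξ) / Λ) ξ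
  pos : ∀ ξ ∈ Ioo (-R) 0, 0 < v ξ
  zero : v 0 = 0
  deriv_zero : p 0 = 0

lemma IsZoneReactant.eq_integral {α Λ c R : ℝ} {v p : ℝ → ℝ} (h : IsZoneReactant α Λ c R v p)
    (hα : 0 < α) (hΛ : 0 < Λ) (hc : 0 < c) {ξ : ℝ} (hξ : ξ ∈ Icc (-R) 0) :
    v ξ = ∫ s in ξ..0, (1 - Real.exp (-(c / Λ) * (s - ξ))) / c * v s ^ α := by
  have := mul_eq_integral (κ := c / Λ) (g := fun s => v s ^ α / Λ) h.continuousOn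
    h.continuousOn_deriv ((h.continuousOn.rpow_const fun _ _ => Or.inr hα.le).div_const Λ)
    h.hasDerivAt (fun x hx => (h.hasDerivAt_deriv x hx).congr_deriv (by ring)) h.deriv_zero hξ
  rw [h.zero, mul_zero, zero_add] at this
  calc v ξ = (c / Λ)⁻¹ * (c / Λ * v ξ) := by field_simp
    _ = _ := by
      rw [this, ← intervalIntegral.integral_const_mul]
      refine intervalIntegral.integral_congr fun s _ => ?_
      have e : -(c / Λ) * (s - ξ) = c / Λ * (ξ - s) := by ring
      simp only [e]
      field_simp

lemma IsZoneReactant.eqOn {α Λ c R : ℝ} {v₁ p₁ v₂ p₂ : ℝ → ℝ} (h₁ : IsZoneReactant α Λ c R v₁ p₁)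
    (h₂ : IsZoneReactant α Λ c R v₂ p₂) (hα : 0 < α) (hΛ : 0 < Λ) (hc : 0 < c) (hR : 0 < R) :
    EqOn v₁ v₂ (Icc (-R) 0) := by
  refine eqOn_of_volterra (K := fun t => (1 - Real.exp (-(c / Λ) * t)) / c) hα (by fun_prop)
    (fun t ht => div_pos (sub_pos.2 (Real.exp_lt_one_iff.2 ?_)) hc) hR h₁.continuousOn h₂.continuousOn
    h₁.pos h₂.pos (fun ξ hξ => h₁.eq_integral hα hΛ hc hξ) (fun ξ hξ => h₂.eq_integral hα hΛ hc hξ)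
  have := mul_pos (div_pos hc hΛ) ht
  linarith

/-! ### Regularity -/

lemma contDiff_two_of_hasDerivAt {f f' f'' : ℝ → ℝ} (h : ∀ x, HasDerivAt f (f' x) x)
    (h' : ∀ x, HasDerivAt f' (f'' x) x) (hc : Continuous f'') : ContDiff ℝ 2 f := by
  have e : deriv f = f' := funext fun x => (h x).deriv
  have e' : deriv f' = f'' := funext fun x => (h' x).deriv
  rw [show (2 : WithTop ℕ∞) = 1 + 1 from (one_add_one_eq_two).symm, contDiff_succ_iff_deriv]
  refine ⟨fun x => (h x).differentiableAt, by simp, ?_⟩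
  rw [e, contDiff_one_iff_deriv, e']
  exact ⟨fun x => (h' x).differentiableAt, hc⟩

/-- A function which is `C¹` on `s` and `C²` on an open subset `o` of `s`: its derivative within
`s` is continuous on `s` and agrees on `o` with the ordinary derivative, which is differentiable. -/
lemma hasDerivAt_derivWithin {f : ℝ → ℝ} {s o : Set ℝ} (ho : IsOpen o) (hos : o ⊆ s)
    (h1 : ContDiffOn ℝ 1 f s) (h2 : ContDiffOn ℝ 2 f o) {x : ℝ} (hx : x ∈ o) :
    derivWithin f s x = deriv f x ∧ HasDerivAt f (derivWithin f s x) x ∧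
      HasDerivAt (derivWithin f s) (deriv (deriv f) x) x := by
  have hnhds : ∀ y ∈ o, s ∈ 𝓝 y := fun y hy => mem_of_superset (ho.mem_nhds hy) hos
  have heq : ∀ y ∈ o, derivWithin f s y = deriv f y := fun y hy =>
    derivWithin_of_mem_nhds (hnhds y hy)
  have hd : DifferentiableAt ℝ f x :=
    (h1.differentiableOn one_ne_zero).differentiableAt (hnhds x hx)
  refine ⟨heq x hx, by rw [heq x hx]; exact hd.hasDerivAt, ?_⟩
  have hd2 : DifferentiableAt ℝ (deriv f) x := by
    have := ((contDiffOn_succ_iff_deriv_of_isOpen (n := 1) ho).1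
      (by rwa [one_add_one_eq_two])).2.2
    exact (this.differentiableOn one_ne_zero).differentiableAt (ho.mem_nhds hx)
  exact hd2.hasDerivAt.congr_of_eventuallyEq <| by
    filter_upwards [ho.mem_nhds hx] with y hy using heq y hy

lemma IsReactionZoneSolution.isZoneReactant {θ α Λ : ℝ} {u v : ℝ → ℝ} {c R : ℝ}
    (h : IsReactionZoneSolution θ α Λ u v c R) (hΛ : 0 < Λ) :
    IsZoneReactant α Λ c R v (derivWithin v (Icc (-R) 0)) := by
  have hR : -R < 0 := neg_lt_zero.2 h.width_pos
  have hud : UniqueDiffOn ℝ (Icc (-R) 0) := uniqueDiffOn_Icc hR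
  have hreg := fun x hx => hasDerivAt_derivWithin isOpen_Ioo Ioo_subset_Icc_self h.v_C1 h.v_C2
    (x := x) hx
  refine ⟨h.v_C1.continuousOn, h.v_C1.continuousOn_derivWithin hud le_rfl,
    fun x hx => (hreg x hx).2.1, fun x hx => (hreg x hx).2.2.congr_deriv ?_, h.v_pos, h.v_tr,
    h.v_tr_deriv.derivWithin (hud 0 ⟨hR.le, le_rfl⟩)⟩
  rw [(hreg x hx).1, eq_div_iff hΛ.ne']
  linear_combination h.v_eq x hx

lemma IsReactantProfile.isZoneReactant {α Λ : ℝ} {w : ℝ → ℝ} (h : IsReactantProfile α Λ w)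
    (hΛ : 0 < Λ) (R : ℝ) : IsZoneReactant α Λ 1 R w (derivWithin w (Iic 0)) := by
  have hud : UniqueDiffOn ℝ (Iic (0 : ℝ)) := uniqueDiffOn_Iic 0
  have hreg := fun x hx => hasDerivAt_derivWithin isOpen_Iio Iio_subset_Iic_self h.w_C1 h.w_C2
    (x := x) hx
  have hsub : Icc (-R) 0 ⊆ Iic (0 : ℝ) := Icc_subset_Iic_self
  refine ⟨h.w_C1.continuousOn.mono hsub, (h.w_C1.continuousOn_derivWithin hud le_rfl).mono hsub,
    fun x hx => (hreg x hx.2).2.1, fun x hx => (hreg x hx.2).2.2.congr_deriv ?_,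
    fun x hx => h.w_pos x hx.2, h.w_zero, h.w_zero_deriv.derivWithin (hud 0 self_mem_Iic)⟩
  rw [(hreg x hx.2).1, eq_div_iff hΛ.ne']
  linear_combination h.w_eq x hx.2

/-- The temperature profile is determined by the reactant profile; the conditions at `-R` turn into
two integral conditions. -/
lemma IsReactionZoneSolution.temperature {θ α Λ : ℝ} {u v : ℝ → ℝ} {c R : ℝ}
    (h : IsReactionZoneSolution θ α Λ u v c R) (hα : 0 < α) :
    (∀ ξ ∈ Icc (-R) 0, c * u ξ = c - ∫ s in ξ..0, (1 - Real.exp (c * (ξ - s))) * v s ^ α) ∧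
      c = (∫ s in (-R)..0, v s ^ α) ∧
      c * θ = ∫ s in (-R)..0, Real.exp (c * (-R - s)) * v s ^ α := by
  have hR : -R < 0 := neg_lt_zero.2 h.width_pos
  have hud : UniqueDiffOn ℝ (Icc (-R) 0) := uniqueDiffOn_Icc hR
  have hreg := fun x hx => hasDerivAt_derivWithin isOpen_Ioo Ioo_subset_Icc_self h.u_C1 h.u_C2
    (x := x) hx
  have hf := h.u_C1.continuousOn
  have hp := h.u_C1.continuousOn_derivWithin hud le_rfl
  have hg : ContinuousOn (fun s => -(v s ^ α)) (Icc (-R) 0) :=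
    (h.v_C1.continuousOn.rpow_const fun _ _ => Or.inr hα.le).neg
  have hp0 := h.u_tr_deriv.derivWithin (hud 0 ⟨hR.le, le_rfl⟩)
  have hpR := h.u_ign_deriv.derivWithin (hud (-R) ⟨le_rfl, hR.le⟩)
  have hfp := fun x hx => (hreg x hx).2.1
  have hpg : ∀ x ∈ Ioo (-R) 0, HasDerivAt (derivWithin u (Icc (-R) 0))
      (c * derivWithin u (Icc (-R) 0) x + -(v x ^ α)) x := fun x hx => by
    refine (hreg x hx).2.2.congr_deriv ?_
    rw [(hreg x hx).1]
    linear_combination h.u_eq x hx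
  have hmem : -R ∈ Icc (-R) 0 := ⟨le_rfl, hR.le⟩
  refine ⟨fun ξ hξ => ?_, ?_, ?_⟩
  · have := mul_eq_integral hf hp hg hfp hpg hp0 hξ
    simp only [mul_neg, intervalIntegral.integral_neg, h.u_tr] at this
    linarith
  · have := deriv_sub_mul_eq hf hp hg hfp hpg hp0 hmem
    simp only [intervalIntegral.integral_neg, h.u_tr, h.u_ign, hpR] at this
    linarith
  · have := deriv_eq_integral_exp hp hg hpg hp0 hmem
    simp only [mul_neg, intervalIntegral.integral_neg, hpR] at this
    linarith

/-! ### Scaling -/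

namespace IsReflectedProfile

variable {α Λ : ℝ} {z p : ℝ → ℝ}

lemma isReactantProfile (h : IsReflectedProfile α Λ z p) (hα : 0 < α) (hΛ : 0 < Λ) :
    IsReactantProfile α Λ fun x => z (-x) := by
  have h1 : ∀ x, HasDerivAt (fun x => z (-x)) (-p (-x)) x := fun x =>
    ((h.hasDerivAt (-x)).scomp x (hasDerivAt_neg x)).congr_deriv (by simp)
  have h2 : ∀ x, HasDerivAt (fun x => -p (-x)) ((z (-x) ^ α - p (-x)) / Λ) x := fun x =>
    (((h.hasDerivAt_deriv (-x)).scomp x (hasDerivAt_neg x)).neg).congr_deriv (by simp)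
  have hz := h.continuous
  have hp := h.continuous_deriv
  have hza := h.continuous_rpow hα
  have hC : ContDiff ℝ 2 fun x => z (-x) := contDiff_two_of_hasDerivAt h1 h2
    (((hza.comp continuous_neg).sub (hp.comp continuous_neg)).div_const Λ)
  have e1 : deriv (fun x => z (-x)) = fun x => -p (-x) := funext fun x => (h1 x).deriv
  refine ⟨(hC.of_le one_le_two).contDiffOn, hC.contDiffOn, fun x _ => ?_,
    fun x hx => h.pos _ (neg_pos.2 hx), by simp [h.of_nonpos 0 le_rfl], ?_⟩
  · rw [e1, (h2 x).deriv]; field_simp; ring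
  · have := (h1 0).hasDerivWithinAt (s := Iic 0)
    simpa [h.deriv_of_nonpos le_rfl] using this

end IsReflectedProfile

/-- The amplitude `k = c ^ (-2 / (1 - α))`, for which `k w(c ξ)` solves the equation with speed `c`
if `w` solves the one with speed `1`. -/
noncomputable def amplitude (α c : ℝ) : ℝ := c ^ (-(2 / (1 - α)))

lemma amplitude_pos {α c : ℝ} (hc : 0 < c) : 0 < amplitude α c := Real.rpow_pos_of_pos hc _

lemma amplitude_rpow {α c : ℝ} (hα : α < 1) (hc : 0 < c) :
    amplitude α c ^ α = amplitude α c * c ^ 2 := by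
  have h1 : 1 - α ≠ 0 := by linarith
  rw [amplitude, ← Real.rpow_mul hc.le, ← Real.rpow_natCast, ← Real.rpow_add hc]
  congr 1
  push_cast
  field_simp
  ring

/-- `c = k ^ α / c * I` is the condition `c = ∫ v ^ α` for the rescaled profile. -/
lemma eq_amplitude_iff {α c I : ℝ} (hα : α < 1) (hc : 0 < c) (hI : 0 < I) :
    c = amplitude α c ^ α * (c⁻¹ * I) ↔ c = I ^ ((1 - α) / 2) := by
  have h1 : 1 - α ≠ 0 := by linarith
  have hk := amplitude_pos (α := α) hc
  have e : amplitude α c * c ^ (2 / (1 - α)) = 1 := by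
    rw [amplitude, ← Real.rpow_add hc]; simp
  rw [amplitude_rpow hα hc]
  have hiff : c = amplitude α c * c ^ 2 * (c⁻¹ * I) ↔ I = c ^ (2 / (1 - α)) := by
    constructor
    · intro h
      have h2 : amplitude α c * I = 1 := by
        field_simp at h
        linarith
      exact mul_left_cancel₀ hk.ne' (h2.trans e.symm)
    · rintro rfl
      calc c = c * (amplitude α c * c ^ (2 / (1 - α))) := by rw [e, mul_one]
        _ = _ := by field_simp
  rw [hiff]
  constructor
  · rintro rfl
    rw [← Real.rpow_mul hc.le, show 2 / (1 - α) * ((1 - α) / 2) = 1 by field_simp, Real.rpow_one]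
  · intro h
    rw [h, ← Real.rpow_mul hI.le, show (1 - α) / 2 * (2 / (1 - α)) = 1 by field_simp,
      Real.rpow_one]

lemma integral_scaled_rpow {α c R : ℝ} {w : ℝ → ℝ} (hc : 0 < c) (hw : ∀ x, 0 ≤ w x) :
    ∫ s in (-R)..0, (amplitude α c * w (c * s)) ^ α =
      amplitude α c ^ α * (c⁻¹ * ∫ s in (-(c * R))..0, w s ^ α) := by
  have := intervalIntegral.integral_comp_mul_left (a := -R) (b := 0) (fun s => w s ^ α) hc.ne'
  rw [mul_zero, mul_neg, smul_eq_mul] at this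
  rw [← this, ← intervalIntegral.integral_const_mul]
  exact intervalIntegral.integral_congr fun s _ => Real.mul_rpow (amplitude_pos hc).le (hw _)

lemma integral_exp_scaled_rpow {α c R : ℝ} {w : ℝ → ℝ} (hc : 0 < c) (hw : ∀ x, 0 ≤ w x) :
    ∫ s in (-R)..0, Real.exp (c * (-R - s)) * (amplitude α c * w (c * s)) ^ α =
      amplitude α c ^ α *
        (c⁻¹ * ∫ s in (-(c * R))..0, w s ^ α * Real.exp (-(s + c * R))) := by
  have := intervalIntegral.integral_comp_mul_left (a := -R) (b := 0)
    (fun s => w s ^ α * Real.exp (-(s + c * R))) hc.ne'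
  rw [mul_zero, mul_neg, smul_eq_mul] at this
  rw [← this, ← intervalIntegral.integral_const_mul]
  refine intervalIntegral.integral_congr fun s _ => ?_
  have e : c * (-R - s) = -(c * s + c * R) := by ring
  simp only [Real.mul_rpow (amplitude_pos (α := α) hc).le (hw _), e]
  ring

namespace IsReflectedProfile

variable {α Λ c : ℝ} {z p : ℝ → ℝ}

lemma hasDerivAt_scaled (h : IsReflectedProfile α Λ z p) (ξ : ℝ) :
    HasDerivAt (fun ξ => amplitude α c * z (-(c * ξ)))
      (amplitude α c * (-c * p (-(c * ξ)))) ξ := by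
  have h1 : HasDerivAt (fun ξ => -(c * ξ)) (-c) ξ :=
    (((hasDerivAt_id ξ).const_mul c).neg).congr_deriv (by simp)
  exact (((h.hasDerivAt _).scomp ξ h1).const_mul _).congr_deriv (by simp)

lemma hasDerivAt_deriv_scaled (h : IsReflectedProfile α Λ z p) (hα : α < 1) (hc : 0 < c)
    (ξ : ℝ) :
    HasDerivAt (fun ξ => amplitude α c * (-c * p (-(c * ξ))))
      (((amplitude α c * z (-(c * ξ))) ^ α +
        c * (amplitude α c * (-c * p (-(c * ξ))))) / Λ) ξ := by
  have h1 : HasDerivAt (fun ξ => -(c * ξ)) (-c) ξ :=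
    (((hasDerivAt_id ξ).const_mul c).neg).congr_deriv (by simp)
  refine ((((h.hasDerivAt_deriv _).scomp ξ h1).const_mul (-c)).const_mul _).congr_deriv ?_
  rw [Real.mul_rpow (amplitude_pos hc).le (h.nonneg _), amplitude_rpow hα hc, smul_eq_mul]
  ring

lemma isZoneReactant (h : IsReflectedProfile α Λ z p) (hα : α < 1) (hc : 0 < c) (R : ℝ) :
    IsZoneReactant α Λ c R (fun ξ => amplitude α c * z (-(c * ξ)))
      (fun ξ => amplitude α c * (-c * p (-(c * ξ)))) where
  continuousOn ξ _ := (h.hasDerivAt_scaled ξ).continuousAt.continuousWithinAt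
  continuousOn_deriv ξ _ := (h.hasDerivAt_deriv_scaled hα hc ξ).continuousAt.continuousWithinAt
  hasDerivAt ξ _ := h.hasDerivAt_scaled ξ
  hasDerivAt_deriv ξ _ := h.hasDerivAt_deriv_scaled hα hc ξ
  pos ξ hξ := mul_pos (amplitude_pos hc) (h.pos _ (neg_pos.2 (mul_neg_of_pos_of_neg hc hξ.2)))
  zero := by simp [h.of_nonpos 0 le_rfl]
  deriv_zero := by simp [h.deriv_of_nonpos le_rfl]

lemma eqOn_reactantProfile (h : IsReflectedProfile α Λ z p) (hα : α ∈ Ioo (0 : ℝ) 1) (hΛ : 0 < Λ)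
    {w : ℝ → ℝ} (hw : IsReactantProfile α Λ w) : EqOn w (fun x => z (-x)) (Iic 0) := by
  intro x hx
  have hx' : x ≤ 0 := hx
  have hR : 0 < 1 - x := by linarith
  have hmem : x ∈ Icc (-(1 - x)) 0 := ⟨by linarith, hx⟩
  have := (hw.isZoneReactant hΛ (1 - x)).eqOn (h.isZoneReactant hα.2 one_pos (1 - x)) hα.1 hΛ
    one_pos hR hmem
  simpa [amplitude] using this

end IsReflectedProfile

/-- Speed and width of a solution, read off from the rescaled profile. -/
lemma IsReactionZoneSolution.eq_scaled {θ α Λ : ℝ} {z p u v : ℝ → ℝ} {c R : ℝ}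
    (h : IsReactionZoneSolution θ α Λ u v c R) (hz : IsReflectedProfile α Λ z p)
    (hα : α ∈ Ioo (0 : ℝ) 1) (hΛ : 0 < Λ) :
    EqOn v (fun ξ => amplitude α c * z (-(c * ξ))) (Icc (-R) 0) ∧
      ignitionRatio α (fun x => z (-x)) (c * R) = θ ∧
      c = (∫ s in (-(c * R))..0, z (-s) ^ α) ^ ((1 - α) / 2) := by
  have hc := h.speed_pos
  have hR := h.width_pos
  have hv : EqOn v (fun ξ => amplitude α c * z (-(c * ξ))) (Icc (-R) 0) :=
    (h.isZoneReactant hΛ).eqOn (hz.isZoneReactant hα.2 hc R) hα.1 hΛ hc hR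
  have hIcc : uIcc (-R) 0 = Icc (-R) 0 := uIcc_of_le (by linarith)
  have hI : 0 < ∫ s in (-(c * R))..0, z (-s) ^ α := by
    have := intervalIntegral.integral_comp_neg (a := -(c * R)) (b := 0) fun t => z t ^ α
    rw [this, neg_zero, neg_neg]
    exact hz.integral_rpow_pos hα.1 (mul_pos hc hR)
  obtain ⟨-, h1, h2⟩ := h.temperature hα.1
  have e1 : c = amplitude α c ^ α * (c⁻¹ * ∫ s in (-(c * R))..0, z (-s) ^ α) := by
    rw [← integral_scaled_rpow (w := fun x => z (-x)) hc fun x => hz.nonneg _]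
    refine h1.trans (intervalIntegral.integral_congr fun s hs => ?_)
    rw [hIcc] at hs
    simp only [hv hs]
  have e2 : c * θ = amplitude α c ^ α *
      (c⁻¹ * ∫ s in (-(c * R))..0, z (-s) ^ α * Real.exp (-(s + c * R))) := by
    rw [← integral_exp_scaled_rpow (w := fun x => z (-x)) hc fun x => hz.nonneg _]
    refine h2.trans (intervalIntegral.integral_congr fun s hs => ?_)
    rw [hIcc] at hs
    simp only [hv hs]
  refine ⟨hv, ?_, (eq_amplitude_iff hα.2 hc hI).1 e1⟩
  rw [ignitionRatio, div_eq_iff hI.ne']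
  have hka : amplitude α c ^ α * c⁻¹ ≠ 0 :=
    mul_ne_zero (Real.rpow_pos_of_pos (amplitude_pos hc) _).ne' (inv_ne_zero hc.ne')
  refine mul_left_cancel₀ hka ?_
  linear_combination θ * e1 - e2

/-! ### Existence for the free-boundary problem -/

/-- The solution of `u'' - c u' = -g`, `u 0 = 1`, `u' 0 = 0`. -/
noncomputable def temperature (c : ℝ) (g : ℝ → ℝ) (ξ : ℝ) : ℝ :=
  1 - ((∫ s in ξ..0, g s) - Real.exp (c * ξ) * ∫ s in ξ..0, Real.exp (-(c * s)) * g s) / c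

/-- The derivative of `temperature c g`. -/
noncomputable def temperatureDeriv (c : ℝ) (g : ℝ → ℝ) (ξ : ℝ) : ℝ :=
  Real.exp (c * ξ) * ∫ s in ξ..0, Real.exp (-(c * s)) * g s

section Temperature

variable {c : ℝ} {g : ℝ → ℝ}

lemma hasDerivAt_temperatureDeriv (hg : Continuous g) (ξ : ℝ) :
    HasDerivAt (temperatureDeriv c g) (c * temperatureDeriv c g ξ - g ξ) ξ := by
  have hc : Continuous fun s => Real.exp (-(c * s)) * g s := by fun_prop
  have h1 := intervalIntegral.integral_hasDerivAt_left (hc.intervalIntegrable ξ 0)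
    (hc.stronglyMeasurableAtFilter _ _) hc.continuousAt
  refine ((((hasDerivAt_id ξ).const_mul c).exp).mul h1).congr_deriv ?_
  have : Real.exp (c * ξ) * Real.exp (-(c * ξ)) = 1 := by rw [← Real.exp_add]; simp
  simp only [temperatureDeriv, id]
  linear_combination (-g ξ) * this

lemma hasDerivAt_temperature (hg : Continuous g) (hc : c ≠ 0) (ξ : ℝ) :
    HasDerivAt (temperature c g) (temperatureDeriv c g ξ) ξ := by
  have h1 := intervalIntegral.integral_hasDerivAt_left (hg.intervalIntegrable ξ 0)
    (hg.stronglyMeasurableAtFilter _ _) hg.continuousAt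
  refine (((h1.sub (hasDerivAt_temperatureDeriv (c := c) hg ξ)).div_const c).const_sub
    1).congr_deriv ?_
  field_simp
  ring

lemma temperature_of_nonneg (hg : ∀ s, 0 ≤ s → g s = 0) {ξ : ℝ} (hξ : 0 ≤ ξ) :
    temperature c g ξ = 1 := by
  have h0 : ∀ s ∈ uIcc ξ 0, g s = 0 := fun s hs => by
    rw [uIcc_of_ge hξ] at hs; exact hg s hs.1
  have h1 : ∫ s in ξ..0, g s = 0 :=
    (intervalIntegral.integral_congr (g := fun _ => 0) h0).trans (by simp)
  have h2 : ∫ s in ξ..0, Real.exp (-(c * s)) * g s = 0 :=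
    (intervalIntegral.integral_congr (g := fun _ => 0)
      fun s hs => by simp [h0 s hs]).trans (by simp)
  simp [temperature, h1, h2]

end Temperature

/-! ### Exponential tails -/

/-- The function `f` on `(a, ∞)`, continued to `(-∞, a]` by the solution of `F'' = κ F'` that has
the value `f a` at `a` and the limit `ℓ` at `-∞`. -/
noncomputable def withTail (κ ℓ a : ℝ) (f : ℝ → ℝ) (ξ : ℝ) : ℝ :=
  if ξ ≤ a then ℓ + (f a - ℓ) * Real.exp (κ * (ξ - a)) else f ξ

section Tail

variable {κ ℓ a : ℝ} {f : ℝ → ℝ}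

lemma withTail_of_le {ξ : ℝ} (h : ξ ≤ a) :
    withTail κ ℓ a f ξ = ℓ + (f a - ℓ) * Real.exp (κ * (ξ - a)) := if_pos h

lemma withTail_of_ge {ξ : ℝ} (h : a ≤ ξ) : withTail κ ℓ a f ξ = f ξ := by
  rcases h.eq_or_lt with rfl | h
  · simp [withTail]
  · exact if_neg (not_le.2 h)

lemma hasDerivAt_tail (A ξ : ℝ) :
    HasDerivAt (fun ξ => ℓ + A * Real.exp (κ * (ξ - a)))
      (κ * (A * Real.exp (κ * (ξ - a)))) ξ := by
  refine ((((((hasDerivAt_id ξ).sub_const a).const_mul κ).exp).const_mul A).const_add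
    ℓ).congr_deriv ?_
  simp only [id]; ring

/-- The continuation is of class `C¹` if the derivatives at `a` match. -/
lemma contDiff_withTail {f' : ℝ → ℝ} (hf : ∀ x, HasDerivAt f (f' x) x) (hf' : Continuous f')
    (ha : f' a = κ * (f a - ℓ)) : ContDiff ℝ 1 (withTail κ ℓ a f) := by
  have hd : ∀ x, HasDerivAt (withTail κ ℓ a f)
      (if x ≤ a then κ * ((f a - ℓ) * Real.exp (κ * (x - a))) else f' x) x := fun x => by
    have hl : ∀ x ∈ Iic a, withTail κ ℓ a f x = ℓ + (f a - ℓ) * Real.exp (κ * (x - a)) :=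
      fun x hx => withTail_of_le hx
    have hr : ∀ x ∈ Ici a, withTail κ ℓ a f x = f x := fun x hx => withTail_of_ge hx
    rcases lt_trichotomy x a with h | rfl | h
    · rw [if_pos h.le]
      exact (hasDerivAt_tail _ x).congr_of_eventuallyEq <| by
        filter_upwards [Iio_mem_nhds h] with y hy using hl y (Iio_subset_Iic_self hy)
    · rw [if_pos le_rfl]
      have h1 := ((hasDerivAt_tail (κ := κ) (ℓ := ℓ) (a := x) (f x - ℓ) x).hasDerivWithinAt
        (s := Iic x)).congr hl (hl x self_mem_Iic)
      have h2 := ((hf x).hasDerivWithinAt (s := Ici x)).congr hr (hr x self_mem_Ici)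
      have h3 := h1.union (h2.congr_deriv (by simp [ha]))
      rwa [Iic_union_Ici, hasDerivWithinAt_univ] at h3
    · rw [if_neg (not_le.2 h)]
      exact (hf x).congr_of_eventuallyEq <| by
        filter_upwards [Ioi_mem_nhds h] with y hy using hr y (Ioi_subset_Ici_self hy)
  rw [contDiff_one_iff_deriv]
  refine ⟨fun x => (hd x).differentiableAt, ?_⟩
  rw [funext fun x => (hd x).deriv]
  exact Continuous.if_le (by fun_prop) hf' continuous_id continuous_const
    fun x hx => by simp [show x = a from hx, ha]

lemma contDiffOn_withTail_Iio : ContDiffOn ℝ 2 (withTail κ ℓ a f) (Iio a) :=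
  (show ContDiff ℝ 2 fun ξ => ℓ + (f a - ℓ) * Real.exp (κ * (ξ - a)) by fun_prop).contDiffOn.congr
    fun _ hx => withTail_of_le (le_of_lt hx)

lemma deriv_deriv_withTail {ξ : ℝ} (hξ : ξ ∈ Iio a) :
    deriv (deriv (withTail κ ℓ a f)) ξ = κ * deriv (withTail κ ℓ a f) ξ := by
  have h1 : EqOn (withTail κ ℓ a f) (fun ξ => ℓ + (f a - ℓ) * Real.exp (κ * (ξ - a))) (Iio a) :=
    fun x hx => withTail_of_le (le_of_lt hx)
  have h2 := h1.deriv isOpen_Iio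
  have e : deriv (fun ξ => ℓ + (f a - ℓ) * Real.exp (κ * (ξ - a))) =
      fun ξ => 0 + κ * (f a - ℓ) * Real.exp (κ * (ξ - a)) := funext fun x => by
    rw [(hasDerivAt_tail _ x).deriv]; ring
  rw [h2.deriv isOpen_Iio hξ, h2 hξ, e, (hasDerivAt_tail _ ξ).deriv]
  ring

lemma tendsto_tail (hκ : 0 < κ) (A : ℝ) :
    Tendsto (fun ξ => ℓ + A * Real.exp (κ * (ξ - a))) atBot (𝓝 ℓ) := by
  have h1 : Tendsto (fun ξ => κ * (ξ - a)) atBot atBot :=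
    (tendsto_atBot_add_const_right _ (-a) tendsto_id).const_mul_atBot hκ
  simpa using ((Real.tendsto_exp_atBot.comp h1).const_mul A).const_add ℓ

lemma tendsto_withTail (hκ : 0 < κ) : Tendsto (withTail κ ℓ a f) atBot (𝓝 ℓ) :=
  (tendsto_tail hκ (f a - ℓ)).congr' <| by
    filter_upwards [eventually_le_atBot a] with x hx using (withTail_of_le hx).symm

/-- A function with `F'' = κ F'` on `(-∞, a)` and limit `ℓ` at `-∞` is an exponential tail; in
particular its value and its derivative at `a` are related. -/
lemma eq_tail_of_deriv_deriv {F : ℝ → ℝ} (hκ : 0 < κ) (hF : ContDiff ℝ 1 F)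
    (hF2 : ContDiffOn ℝ 2 F (Iio a)) (hode : ∀ ξ ∈ Iio a, deriv (deriv F) ξ = κ * deriv F ξ)
    (hlim : Tendsto F atBot (𝓝 ℓ)) :
    (∀ ξ ≤ a, F ξ = ℓ + (F a - ℓ) * Real.exp (κ * (ξ - a))) ∧ deriv F a = κ * (F a - ℓ) := by
  have hd : ∀ x, HasDerivAt F (deriv F x) x := fun x =>
    (hF.differentiable one_ne_zero x).hasDerivAt
  have hdc : Continuous (deriv F) := hF.continuous_deriv le_rfl
  have hd2 : ∀ x ∈ Iio a, HasDerivAt (deriv F) (κ * deriv F x) x := fun x hx => by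
    rw [← hode x hx]
    have := ((contDiffOn_succ_iff_deriv_of_isOpen (n := 1) isOpen_Iio).1
      (by rwa [one_add_one_eq_two])).2.2
    exact ((this.differentiableOn one_ne_zero).differentiableAt (Iio_mem_nhds hx)).hasDerivAt
  have hconst : ∀ {G : ℝ → ℝ}, Continuous G → (∀ x ∈ Iio a, HasDerivAt G 0 x) →
      ∀ x ≤ a, G x = G a := fun {G} hG hG' x hx => by
    rcases hx.eq_or_lt with rfl | hx
    · rfl
    have := constant_of_has_deriv_right_zero (f := G) (a := x) (b := a) hG.continuousOn
      (fun y hy => (hG' y hy.2).hasDerivWithinAt)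
    exact (this a ⟨hx.le, le_rfl⟩).symm
  have h1 : ∀ x ≤ a, deriv F x - κ * F x = deriv F a - κ * F a :=
    hconst (G := fun x => deriv F x - κ * F x) (hdc.sub (continuous_const.mul hF.continuous))
      fun x hx => ((hd2 x hx).sub ((hd x).const_mul κ)).congr_deriv (by ring)
  set C := deriv F a - κ * F a with hC
  have h2 : ∀ x ≤ a, Real.exp (-(κ * (x - a))) * (F x + C / κ) = F a + C / κ := by
    intro x hx
    have := hconst (G := fun x => Real.exp (-(κ * (x - a))) * (F x + C / κ))
      (by have := hF.continuous; fun_prop) (fun x hx => ?_) x hx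
    · simpa using this
    · have hE : HasDerivAt (fun x => Real.exp (-(κ * (x - a))))
          (Real.exp (-(κ * (x - a))) * -(κ * 1)) x :=
        (((hasDerivAt_id x).sub_const a).const_mul κ).neg.exp
      refine (hE.mul ((hd x).add_const (C / κ))).congr_deriv ?_
      linear_combination Real.exp (-(κ * (x - a))) * h1 x (le_of_lt hx) -
        Real.exp (-(κ * (x - a))) * mul_div_cancel₀ C hκ.ne'
  have h3 : ∀ x ≤ a, F x = -(C / κ) + (F a + C / κ) * Real.exp (κ * (x - a)) := fun x hx => by
    have e : Real.exp (-(κ * (x - a))) * Real.exp (κ * (x - a)) = 1 := by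
      rw [← Real.exp_add]; simp
    linear_combination (Real.exp (κ * (x - a))) * h2 x hx - (F x + C / κ) * e
  have hℓ : ℓ = -(C / κ) := tendsto_nhds_unique hlim <|
    (tendsto_tail hκ (F a + C / κ)).congr' <| by
      filter_upwards [eventually_le_atBot a] with x hx using (h3 x hx).symm
  refine ⟨fun ξ hξ => ?_, ?_⟩
  · rw [h3 ξ hξ, hℓ]; ring
  · rw [hℓ]
    field_simp
    rw [hC]; ring

end Tail

/-! ### Fronts -/

/-- A traveling front, translated so that its trailing interface is at `0`, solves the problem on
the reaction zone: as `u` is an exponential tail with limit `0` ahead of the ignition interface,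
`u' = c θ` holds there. -/
lemma IsTravelingFront.isReactionZoneSolution {θ α Λ : ℝ} {u v : ℝ → ℝ} {c a b : ℝ}
    (h : IsTravelingFront θ α Λ u v c a b) :
    IsReactionZoneSolution θ α Λ (fun ξ => u (ξ + b)) (fun ξ => v (ξ + b)) c (b - a) := by
  have hab := h.ign_lt_tr
  have hmem : ∀ ξ ∈ Ioo (-(b - a)) 0, ξ + b ∈ Ioo a b := fun ξ hξ =>
    ⟨by linarith [hξ.1], by linarith [hξ.2]⟩
  have hshift : ContDiff ℝ 2 fun ξ : ℝ => ξ + b := by fun_prop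
  have hdu : ∀ x, HasDerivAt u (deriv u x) x := fun x =>
    (h.u_C1.differentiable one_ne_zero x).hasDerivAt
  have hdv : ∀ x, HasDerivAt v (deriv v x) x := fun x =>
    (h.v_C1.differentiable one_ne_zero x).hasDerivAt
  -- beyond `b` the front is constant, so its right derivative at `b` vanishes
  have hz : ∀ {f : ℝ → ℝ} {k : ℝ}, (∀ ξ ∈ Ici b, f ξ = k) → HasDerivAt f (deriv f b) b →
      deriv f b = 0 := fun {f k} hf hd =>
    (uniqueDiffOn_Ici b b self_mem_Ici).eq_deriv _ (hd.hasDerivWithinAt (s := Ici b))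
      ((hasDerivWithinAt_const b (Ici b) k).congr hf (hf b self_mem_Ici))
  have hsh : ∀ {f : ℝ → ℝ}, (∀ x, HasDerivAt f (deriv f x) x) → ∀ ξ,
      HasDerivAt (fun ξ => f (ξ + b)) (deriv f (ξ + b)) ξ := fun hf ξ => (hf _).comp_add_const ξ b
  have e1 : ∀ f : ℝ → ℝ, deriv (fun ξ => f (ξ + b)) = fun ξ => deriv f (ξ + b) := fun f =>
    funext fun ξ => deriv_comp_add_const f b ξ
  have htail := eq_tail_of_deriv_deriv h.speed_pos h.u_C1 h.u_C2_left
    (fun ξ hξ => by linarith [h.u_eq_left ξ hξ]) h.u_unburned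
  refine
    { speed_pos := h.speed_pos
      width_pos := sub_pos.2 hab
      u_C1 := (h.u_C1.comp (hshift.of_le one_le_two)).contDiffOn
      v_C1 := (h.v_C1.comp (hshift.of_le one_le_two)).contDiffOn
      u_C2 := h.u_C2.comp hshift.contDiffOn hmem
      v_C2 := h.v_C2.comp hshift.contDiffOn hmem
      u_eq := fun ξ hξ => ?_
      v_eq := fun ξ hξ => ?_
      v_pos := fun ξ hξ => h.v_pos _ (hmem ξ hξ)
      u_ign := by simp [h.u_ign]
      u_ign_deriv := ?_
      u_tr := by simp [h.u_burned b self_mem_Ici]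
      u_tr_deriv := ?_
      v_tr := by simp [h.v_burned b self_mem_Ici]
      v_tr_deriv := ?_ }
  · rw [e1, e1]; exact h.u_eq _ (hmem ξ hξ)
  · rw [e1, e1]; exact h.v_eq _ (hmem ξ hξ)
  · refine ((hsh hdu _).congr_deriv ?_).hasDerivWithinAt
    rw [neg_sub, sub_add_cancel, htail.2, h.u_ign, sub_zero]
  · exact ((hsh hdu 0).congr_deriv (by rw [zero_add, hz h.u_burned (hdu b)])).hasDerivWithinAt
  · exact ((hsh hdv 0).congr_deriv (by rw [zero_add, hz h.v_burned (hdv b)])).hasDerivWithinAt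

lemma IsTravelingFront.eq_tails {θ α Λ : ℝ} {u v : ℝ → ℝ} {c a b : ℝ}
    (h : IsTravelingFront θ α Λ u v c a b) (hΛ : 0 < Λ) {ξ : ℝ} (hξ : ξ ≤ a) :
    u ξ = θ * Real.exp (c * (ξ - a)) ∧ v ξ = 1 + (v a - 1) * Real.exp (c / Λ * (ξ - a)) := by
  have hu := eq_tail_of_deriv_deriv h.speed_pos h.u_C1 h.u_C2_left
    (fun ξ hξ => by linarith [h.u_eq_left ξ hξ]) h.u_unburned
  have hv := eq_tail_of_deriv_deriv (div_pos h.speed_pos hΛ) h.v_C1 h.v_C2_left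
    (fun ξ hξ => by
      have := h.v_eq_left ξ hξ
      field_simp
      linarith) h.v_unburned
  exact ⟨by rw [hu.1 ξ hξ, h.u_ign]; ring, hv.1 ξ hξ⟩

/-- The tails of a front are determined by the speed, the interface and the value of `v` there, so
two fronts that agree on the reaction zone agree everywhere. -/
lemma IsTravelingFront.eq_of_eqOn {θ α Λ : ℝ} {U V U₁ V₁ : ℝ → ℝ} {c a b R : ℝ}
    (h : IsTravelingFront θ α Λ U V c (-R) 0) (h₁ : IsTravelingFront θ α Λ U₁ V₁ c a b)
    (hΛ : 0 < Λ) (hR : b - a = R) (hU : EqOn (fun ξ => U₁ (ξ + b)) U (Icc (-R) 0))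
    (hV : EqOn (fun ξ => V₁ (ξ + b)) V (Icc (-R) 0)) (ξ : ℝ) :
    U₁ ξ = U (ξ - b) ∧ V₁ ξ = V (ξ - b) := by
  have hab := h₁.ign_lt_tr
  rcases le_or_gt ξ a with hξ | hξ
  · obtain ⟨h1, h2⟩ := h₁.eq_tails hΛ hξ
    obtain ⟨h3, h4⟩ := h.eq_tails hΛ (ξ := ξ - b) (by linarith)
    have e : ξ - b - -R = ξ - a := by linarith
    have hVa : V₁ a = V (-R) := by
      have := hV (show -R ∈ Icc (-R) 0 from ⟨le_rfl, by linarith⟩)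
      simp only at this
      rw [← this]; congr 1; linarith
    rw [h1, h2, h3, h4, e, hVa]
    exact ⟨rfl, rfl⟩
  rcases le_or_gt ξ b with hξb | hξb
  · have hm : ξ - b ∈ Icc (-R) 0 := ⟨by linarith, by linarith⟩
    have h1 := hU hm
    have h2 := hV hm
    simp only [sub_add_cancel] at h1 h2
    exact ⟨h1, h2⟩
  · have hm : ξ - b ∈ Ici (0 : ℝ) := sub_nonneg.2 hξb.le
    rw [h₁.u_burned ξ hξb.le, h₁.v_burned ξ hξb.le, h.u_burned _ hm, h.v_burned _ hm]
    exact ⟨rfl, rfl⟩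

lemma IsReactionZoneSolution.eqOn {θ α Λ : ℝ} {u₁ v₁ u₂ v₂ : ℝ → ℝ} {c R : ℝ}
    (h₁ : IsReactionZoneSolution θ α Λ u₁ v₁ c R) (h₂ : IsReactionZoneSolution θ α Λ u₂ v₂ c R)
    (hα : 0 < α) (hΛ : 0 < Λ) : EqOn u₁ u₂ (Icc (-R) 0) ∧ EqOn v₁ v₂ (Icc (-R) 0) := by
  have hv := (h₁.isZoneReactant hΛ).eqOn (h₂.isZoneReactant hΛ) hα hΛ h₁.speed_pos h₁.width_pos
  refine ⟨fun ξ hξ => mul_left_cancel₀ h₁.speed_pos.ne' ?_, hv⟩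
  rw [(h₁.temperature hα).1 ξ hξ, (h₂.temperature hα).1 ξ hξ]
  congr 1
  refine intervalIntegral.integral_congr fun s hs => ?_
  simp only [hv (uIcc_subset_Icc_neg_zero hξ hs)]

/-- A pair of functions on `ℝ` that is of class `C²` across the trailing interface and satisfies the
reaction zone equations on `(-R, 0)`, the matching conditions at `-R`, and is burned on `[0, ∞)`,
gives rise both to a solution on the reaction zone and to a front. -/
lemma isReactionZoneSolution_and_isTravelingFront {θ α Λ c R : ℝ} {u u' u'' v v' v'' : ℝ → ℝ}
    (hΛ : 0 < Λ) (hc : 0 < c) (hR : 0 < R)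
    (hu : ∀ x, HasDerivAt u (u' x) x) (hu' : ∀ x, HasDerivAt u' (u'' x) x) (hu'' : Continuous u'')
    (hv : ∀ x, HasDerivAt v (v' x) x) (hv' : ∀ x, HasDerivAt v' (v'' x) x) (hv'' : Continuous v'')
    (hequ : ∀ x, u'' x - c * u' x = -(v x) ^ α) (heqv : ∀ x, Λ * v'' x - c * v' x = v x ^ α)
    (hpos : ∀ x < 0, 0 < v x) (hu1 : ∀ x, 0 ≤ x → u x = 1) (hv0 : ∀ x, 0 ≤ x → v x = 0)
    (hu0' : u' 0 = 0) (hv0' : v' 0 = 0)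
    (huR : u (-R) = θ) (huR' : u' (-R) = c * θ) (hvR' : v' (-R) = c / Λ * (v (-R) - 1)) :
    IsReactionZoneSolution θ α Λ u v c R ∧
      IsTravelingFront θ α Λ (withTail c 0 (-R) u) (withTail (c / Λ) 1 (-R) v) c (-R) 0 := by
  have hu2 : ContDiff ℝ 2 u := contDiff_two_of_hasDerivAt hu hu' hu''
  have hv2 : ContDiff ℝ 2 v := contDiff_two_of_hasDerivAt hv hv' hv''
  have eu : deriv u = u' := funext fun x => (hu x).deriv
  have ev : deriv v = v' := funext fun x => (hv x).deriv
  have eu' : deriv u' = u'' := funext fun x => (hu' x).deriv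
  have ev' : deriv v' = v'' := funext fun x => (hv' x).deriv
  have hcu' : Continuous u' := continuous_iff_continuousAt.2 fun x => (hu' x).continuousAt
  have hcv' : Continuous v' := continuous_iff_continuousAt.2 fun x => (hv' x).continuousAt
  have hR0 : -R ≤ 0 := by linarith
  have hEq : ∀ {κ ℓ : ℝ} {f : ℝ → ℝ}, EqOn (withTail κ ℓ (-R) f) f (Ioo (-R) 0) :=
    fun {_ _ _} _ hξ => withTail_of_ge hξ.1.le
  refine ⟨⟨hc, hR, (hu2.of_le one_le_two).contDiffOn, (hv2.of_le one_le_two).contDiffOn,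
    hu2.contDiffOn, hv2.contDiffOn, fun ξ _ => by rw [eu, eu', hequ],
    fun ξ _ => by rw [ev, ev', heqv],
    fun ξ hξ => hpos ξ hξ.2, huR, (hu (-R)).hasDerivWithinAt.congr_deriv huR', hu1 0 le_rfl,
    (hu 0).hasDerivWithinAt.congr_deriv hu0', hv0 0 le_rfl, (hv 0).hasDerivWithinAt.congr_deriv hv0'⟩, ?_⟩
  exact
    { speed_pos := hc
      ign_lt_tr := by linarith
      u_C1 := contDiff_withTail hu hcu' (by rw [huR', huR, sub_zero])
      v_C1 := contDiff_withTail hv hcv' hvR'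
      u_C2_left := contDiffOn_withTail_Iio
      v_C2_left := contDiffOn_withTail_Iio
      u_C2 := hu2.contDiffOn.congr hEq
      v_C2 := hv2.contDiffOn.congr hEq
      u_eq_left := fun ξ hξ => by rw [deriv_deriv_withTail hξ, sub_self]
      v_eq_left := fun ξ hξ => by
        rw [deriv_deriv_withTail hξ]; field_simp; ring
      u_eq := fun ξ hξ => by
        rw [(hEq.deriv isOpen_Ioo).deriv isOpen_Ioo hξ, hEq.deriv isOpen_Ioo hξ, hEq hξ, eu, eu',
          hequ]
      v_eq := fun ξ hξ => by
        rw [(hEq.deriv isOpen_Ioo).deriv isOpen_Ioo hξ, hEq.deriv isOpen_Ioo hξ, hEq hξ, ev, ev',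
          heqv]
      v_pos_left := fun ξ hξ => by
        rw [withTail_of_le (le_of_lt hξ)]
        have h1 := hpos (-R) (by linarith)
        have h2 : Real.exp (c / Λ * (ξ - -R)) ≤ 1 := Real.exp_le_one_iff.2
          (mul_nonpos_of_nonneg_of_nonpos (by positivity) (sub_nonpos.2 (le_of_lt hξ)))
        have h3 := Real.exp_pos (c / Λ * (ξ - -R))
        have h4 := mul_pos h1 h3
        linarith
      v_pos := fun ξ hξ => by rw [hEq hξ]; exact hpos ξ hξ.2
      u_ign := by rw [withTail_of_ge le_rfl, huR]
      u_burned := fun ξ hξ => by rw [withTail_of_ge (hR0.trans hξ), hu1 ξ hξ]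
      v_burned := fun ξ hξ => by rw [withTail_of_ge (hR0.trans hξ), hv0 ξ hξ]
      u_unburned := tendsto_withTail hc
      v_unburned := tendsto_withTail (by positivity) }

/-- The solution and the front built from the profile `w x = z (-x)` and the root `σ` of `φ σ = θ`. -/
lemma exists_solution_and_front {θ α Λ : ℝ} {z p : ℝ → ℝ} (hz : IsReflectedProfile α Λ z p)
    (hα : α ∈ Ioo (0 : ℝ) 1) (hΛ : 0 < Λ) {σ c : ℝ} (hσ : 0 < σ)
    (hθ : ignitionRatio α (fun x => z (-x)) σ = θ)
    (hcI : c = (∫ s in (-σ)..0, z (-s) ^ α) ^ ((1 - α) / 2)) :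
    ∃ u v : ℝ → ℝ, IsReactionZoneSolution θ α Λ u v c (σ / c) ∧
      IsTravelingFront θ α Λ (withTail c 0 (-(σ / c)) u) (withTail (c / Λ) 1 (-(σ / c)) v) c
        (-(σ / c)) 0 := by
  have hI : 0 < ∫ s in (-σ)..0, z (-s) ^ α := by
    have := intervalIntegral.integral_comp_neg (a := -σ) (b := 0) fun t => z t ^ α
    rw [this, neg_zero, neg_neg]
    exact hz.integral_rpow_pos hα.1 hσ
  have hc : 0 < c := by rw [hcI]; exact Real.rpow_pos_of_pos hI _
  have hR : 0 < σ / c := div_pos hσ hc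
  have hcR : c * (σ / c) = σ := mul_div_cancel₀ σ hc.ne'
  set R := σ / c
  set v : ℝ → ℝ := fun ξ => amplitude α c * z (-(c * ξ)) with hvdef
  set v' : ℝ → ℝ := fun ξ => amplitude α c * (-c * p (-(c * ξ))) with hv'def
  have hv : ∀ x, HasDerivAt v (v' x) x := hz.hasDerivAt_scaled
  have hv' : ∀ x, HasDerivAt v' ((v x ^ α + c * v' x) / Λ) x := hz.hasDerivAt_deriv_scaled hα.2 hc
  have hvc : Continuous v := continuous_iff_continuousAt.2 fun x => (hv x).continuousAt
  have hv'c : Continuous v' := continuous_iff_continuousAt.2 fun x => (hv' x).continuousAt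
  have hg : Continuous fun s => v s ^ α := continuous_rpow_of_pos hα.1 hvc
  have hv0 : ∀ x, 0 ≤ x → v x = 0 := fun x hx => by
    simp [hvdef, hz.of_nonpos _ (neg_nonpos.2 (mul_nonneg hc.le hx))]
  have hv'0 : v' 0 = 0 := by simp [hv'def, hz.deriv_of_nonpos le_rfl]
  have hg0 : ∀ x, 0 ≤ x → v x ^ α = 0 := fun x hx => by rw [hv0 x hx, Real.zero_rpow hα.1.ne']
  have hint : ∫ s in (-R)..0, v s ^ α = c := by
    have := integral_scaled_rpow (α := α) (R := R) (w := fun x => z (-x)) hc fun x => hz.nonneg _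
    rw [hcR] at this
    exact this.trans ((eq_amplitude_iff hα.2 hc hI).2 hcI).symm
  have hintexp : temperatureDeriv c (fun s => v s ^ α) (-R) = c * θ := by
    have h1 := integral_exp_scaled_rpow (α := α) (R := R) (w := fun x => z (-x)) hc
      fun x => hz.nonneg _
    rw [hcR] at h1
    have h2 := (eq_amplitude_iff hα.2 hc hI).2 hcI
    rw [ignitionRatio, div_eq_iff hI.ne'] at hθ
    rw [hθ] at h1
    rw [temperatureDeriv, ← intervalIntegral.integral_const_mul]
    calc _ = ∫ s in (-R)..0, Real.exp (c * (-R - s)) * v s ^ α := by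
          refine intervalIntegral.integral_congr fun s _ => ?_
          rw [← mul_assoc, ← Real.exp_add]
          congr 2; ring
      _ = c * θ := h1.trans (by linear_combination (-θ) * h2)
  have hu := hasDerivAt_temperature hg hc.ne'
  have hu' := hasDerivAt_temperatureDeriv (c := c) hg
  have hu'c : Continuous (temperatureDeriv c fun s => v s ^ α) :=
    continuous_iff_continuousAt.2 fun x => (hu' x).continuousAt
  -- the first integral of the reactant equation at `-R` is the matching condition for the tail
  have hvR' : v' (-R) = c / Λ * (v (-R) - 1) := by
    have := deriv_sub_mul_eq (κ := c / Λ) (g := fun s => v s ^ α / Λ) (f := v) (p := v')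
      hvc.continuousOn hv'c.continuousOn (hg.div_const Λ).continuousOn (fun x _ => hv x)
      (fun x _ => (hv' x).congr_deriv (by ring)) hv'0 (ξ := -R) ⟨le_rfl, by linarith⟩
    rw [intervalIntegral.integral_div, hint, hv0 0 le_rfl] at this
    linear_combination this
  refine ⟨temperature c fun s => v s ^ α, v, isReactionZoneSolution_and_isTravelingFront hΛ hc hR
    hu hu' (by fun_prop) hv hv' (by fun_prop) (fun x => by ring) (fun x => by field_simp; ring)
    (fun x hx => mul_pos (amplitude_pos hc) (hz.pos _ (neg_pos.2 (mul_neg_of_pos_of_neg hc hx))))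
    (fun x hx => temperature_of_nonneg hg0 hx) hv0 (by simp [temperatureDeriv]) hv'0 ?_ hintexp
    hvR'⟩
  have e : temperature c (fun s => v s ^ α) (-R) =
      1 - ((∫ s in (-R)..0, v s ^ α) - temperatureDeriv c (fun s => v s ^ α) (-R)) / c := rfl
  rw [e, hint, hintexp]
  field_simp
  ring

theorem theorem1 (θ α Λ : ℝ) (hθ : θ ∈ Set.Ioo (0 : ℝ) 1) (hα : α ∈ Set.Ioo (0 : ℝ) 1)
    (hΛ : 0 < Λ) :
    ∃ (u v : ℝ → ℝ) (c R : ℝ),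
      -- `(u, v, c, R)` is the only solution of the free-boundary problem
      IsReactionZoneSolution θ α Λ u v c R ∧
      (∀ (u₁ v₁ : ℝ → ℝ) (c₁ R₁ : ℝ), IsReactionZoneSolution θ α Λ u₁ v₁ c₁ R₁ →
        c₁ = c ∧ R₁ = R ∧ EqOn u₁ u (Icc (-R) 0) ∧ EqOn v₁ v (Icc (-R) 0)) ∧
      -- it extends to a traveling front, which is unique up to translation
      (∃ U V : ℝ → ℝ,
        IsTravelingFront θ α Λ U V c (-R) 0 ∧
        EqOn U u (Icc (-R) 0) ∧ EqOn V v (Icc (-R) 0) ∧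
        ∀ (U₁ V₁ : ℝ → ℝ) (c₁ a b : ℝ), IsTravelingFront θ α Λ U₁ V₁ c₁ a b →
          c₁ = c ∧ b - a = R ∧ (∀ ξ, U₁ ξ = U (ξ - b)) ∧ (∀ ξ, V₁ ξ = V (ξ - b))) ∧
      -- speed and width are given by the unique `σ` with `φ(σ) = θ`
      (∃ w : ℝ → ℝ,
        IsReactantProfile α Λ w ∧
        (∀ w₁ : ℝ → ℝ, IsReactantProfile α Λ w₁ → EqOn w₁ w (Iic 0)) ∧
        StrictAntiOn (ignitionRatio α w) (Ioi 0) ∧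
        BijOn (ignitionRatio α w) (Ioi 0) (Ioo 0 1) ∧
        ∃ σ : ℝ, 0 < σ ∧ ignitionRatio α w σ = θ ∧
          c = (∫ s in (-σ)..0, (w s) ^ α) ^ ((1 - α) / 2) ∧ R = σ / c) := by
  obtain ⟨z, p, hz⟩ := exists_isReflectedProfile hα hΛ
  have hbij := hz.bijOn_ignitionRatio hα hΛ
  obtain ⟨σ, hσ, hσθ⟩ := hbij.surjOn hθ
  obtain ⟨c, hcI⟩ : ∃ c, c = (∫ s in (-σ)..0, z (-s) ^ α) ^ ((1 - α) / 2) := ⟨_, rfl⟩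
  obtain ⟨u, v, huv, hUV⟩ := exists_solution_and_front hz hα hΛ hσ hσθ hcI
  have huniq : ∀ (u₁ v₁ : ℝ → ℝ) (c₁ R₁ : ℝ), IsReactionZoneSolution θ α Λ u₁ v₁ c₁ R₁ →
      c₁ = c ∧ R₁ = σ / c ∧ EqOn u₁ u (Icc (-(σ / c)) 0) ∧ EqOn v₁ v (Icc (-(σ / c)) 0) := by
    intro u₁ v₁ c₁ R₁ h₁
    obtain ⟨-, hr, hs⟩ := h₁.eq_scaled hz hα hΛ
    have hcR : c₁ * R₁ = σ :=
      hbij.injOn (mul_pos h₁.speed_pos h₁.width_pos) hσ (hr.trans hσθ.symm)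
    obtain rfl : c₁ = c := by rw [hs, hcI, hcR]
    obtain rfl : R₁ = σ / c₁ := by rw [← hcR, mul_div_cancel_left₀ _ h₁.speed_pos.ne']
    exact ⟨rfl, rfl, h₁.eqOn huv hα.1 hΛ⟩
  have hUu : EqOn (withTail c 0 (-(σ / c)) u) u (Icc (-(σ / c)) 0) := fun ξ hξ =>
    withTail_of_ge hξ.1
  have hVv : EqOn (withTail (c / Λ) 1 (-(σ / c)) v) v (Icc (-(σ / c)) 0) := fun ξ hξ =>
    withTail_of_ge hξ.1
  refine ⟨u, v, c, σ / c, huv, huniq, ⟨_, _, hUV, hUu, hVv, ?_⟩, fun x => z (-x),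
    hz.isReactantProfile hα.1 hΛ, fun w₁ hw₁ => hz.eqOn_reactantProfile hα hΛ hw₁,
    hz.strictAntiOn_ignitionRatio hα hΛ, hbij, σ, hσ, hσθ, hcI, rfl⟩
  intro U₁ V₁ c₁ a b h₁
  obtain ⟨rfl, hR, hu, hv⟩ := huniq _ _ _ _ h₁.isReactionZoneSolution
  have := hUV.eq_of_eqOn h₁ hΛ hR (hu.trans hUu.symm) (hv.trans hVv.symm)
  exact ⟨rfl, hR, fun ξ => (this ξ).1, fun ξ => (this ξ).2⟩
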